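/- For each $n\ge 2$ let $K_n$ be the complete graph on $\{1,\dots,n\}$ with i.i.d. edge weights $X_e$ distributed as $Z^{s_n}$, where $(s_n)\subset(0,\infty)$ and $Z$ is a positive random variable with continuous distribution function $G$; assume that for some $\hat x>0$, $G\in C^2([0,\hat x])$, $G$ is strictly increasing on $[0,\hat x]$, and $G'(0+)>0$. The weight of a path is the sum of the weights of its edges. Fix, for each $n\ge2$, two distinct vertices of $K_n$; let $W_n$ be the minimal weight of a self-avoiding path between them, and let $H_n$ (the hopcount) be the number of edges of the minimal weight path, which is almost surely unique. Let $F_n$ be the distribution function of $Z^{s_n}$ and let $u_n$ be the positive solution of $nF_n(u_n)=1$, which exists and is unique for all large $n$. Assume that $s_n\log n\to\infty$ and $s_n^2\log n\to0$ as $n\to\infty$, and put $\varepsilon_n=\sqrt{s_n\log\log n}$. Then $\varepsilon_n\to0$, and with probability tending to $1$, $$(1-\varepsilon_n)\,e\,\lfloor s_n\log n\rfloor\,u_n\le W_n\le e\,\lceil s_n\log n\rceil\,u_n .$$ In particular $\dfrac{W_n}{u_n s_n\log n}\to e$ in probability, and moreover $\dfrac{H_n}{s_n\log n}\to1$ in probability.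 -/

import Mathlib

open MeasureTheory ProbabilityTheory Filter
open scoped Topology ENNReal

noncomputable section

namespace FPP

/-- The complete graph `K_n` on the vertex set `{1, …, n}`, realised as a graph on `ℕ` in which
all natural numbers outside `{1, …, n}` are isolated. Its edge set is exactly the edge set of the
complete graph on `{1, …, n}`. -/
def completeGraphOn (n : ℕ) : SimpleGraph ℕ where
  Adj i j := i ≠ j ∧ i ∈ Set.Icc 1 n ∧ j ∈ Set.Icc 1 n
  symm := ⟨fun _ _ h => ⟨h.1.symm, h.2.2, h.2.1⟩⟩
  loopless := ⟨fun _ h => h.1 rfl⟩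

/-- Self-avoiding paths of `K_n` between the vertices `a` and `b`. -/
abbrev SAPath (n a b : ℕ) : Type := (completeGraphOn n).Path a b

/-- The weight of a path: the sum of the weights `x e` of its edges. -/
def weight {n a b : ℕ} (x : Sym2 ℕ → ℝ) (p : SAPath n a b) : ℝ :=
  (p.1.edges.map x).sum

/-- `p` has minimal weight among all self-avoiding paths of `K_n` between `a` and `b`. -/
def IsOptimal {n a b : ℕ} (x : Sym2 ℕ → ℝ) (p : SAPath n a b) : Prop :=
  ∀ q : SAPath n a b, weight x p ≤ weight x q

/-- The minimal weight of a self-avoiding path of `K_n` between `a` and `b`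
(there are only finitely many such paths, so the infimum is a minimum). -/
def minWeight (n a b : ℕ) (x : Sym2 ℕ → ℝ) : ℝ :=
  ⨅ p : SAPath n a b, weight x p

/-- The hopcount: the number of edges of the path of minimal weight between `a` and `b`
(should there be several such paths, the least number of edges of such a path). -/
def hopcount (n a b : ℕ) (x : Sym2 ℕ → ℝ) : ℕ :=
  sInf {k : ℕ | ∃ p : SAPath n a b, IsOptimal x p ∧ p.1.length = k}

/-- The positive solutions `x` of `n F(x) = 1`. -/
def scaleSet (n : ℕ) (F : ℝ → ℝ) : Set ℝ := {x : ℝ | 0 < x ∧ (n : ℝ) * F x = 1}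

/-- The scale `u_n` of the minimum of `n` weights with distribution function `F`: the positive
solution of `n F(u_n) = 1`, when there is exactly one. -/
def scale (n : ℕ) (F : ℝ → ℝ) : ℝ := sInf (scaleSet n F)

/-- Convergence in probability to the constant `c` of random variables `Y n`, each defined on
its own probability space. -/
def TendstoInProb {Ω : ℕ → Type*} [∀ n, MeasurableSpace (Ω n)] (P : ∀ n, Measure (Ω n))
    (Y : ∀ n, Ω n → ℝ) (c : ℝ) : Prop :=
  ∀ δ : ℝ, 0 < δ → Tendsto (fun n => P n {ω | δ ≤ |Y n ω - c|}) atTop (𝓝 0)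

/-- The events `A n` occur with high probability. -/
def Whp {Ω : ℕ → Type*} [∀ n, MeasurableSpace (Ω n)] (P : ∀ n, Measure (Ω n))
    (A : ∀ n, Set (Ω n)) : Prop :=
  Tendsto (fun n => P n (A n)) atTop (𝓝 1)

end FPP

end

/-! On the scale `u n` an edge is lighter than `x * u n` with probability about `x ^ (1 / s n) / n`.
A path with `k` edges is therefore lighter than `w * u n` with probability about `((w / k) ^ (1 / s
n) / n) ^ k`, up to logarithmic factors. Since there are about `n ^ (k - 1)` paths of length `k`,
the expected number of light ones is about `exp (-log n + k * log (w / k) / s n)`. The function `k *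
log (w / k)` has maximum `w / e`, attained at `k = w / e`. Light paths thus appear when `w` reaches
`e * s n * log n`, and they have about `s n * log n` edges.

The lower bound is a first moment argument. Markov's inequality is applied to a product of negative
powers of the edge weights (`measure_weight_le_le`), with an exponent just short of the one where
the moment diverges. This gives `measure_exists_path_le_exp`, whose error is an inflation of `w` by
`exp ν` with `ν` of order `s n * log log n`, that is, of order `ε n ^ 2`. Reducing `w` by the factor
`1 - ε n` outweighs it (`tendsto_lower_exponent`). The same estimate, with the strict maximum
`mul_one_sub_log_le`, excludes atypical lengths at the critical weight and so controls the hopcount.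

The upper bound is a second moment argument for `k = ⌈s n * log n⌉₊`. Paths are counted whose edges
all lie below a threshold `T` slightly above `e * u n`, at most half of them in a thin layer under
`T`. The overshoot of `T` makes the expected number large, and the edges below the layer compensate
for it in the total weight (`second_moment_bound`). Pair correlations depend only on the number of
shared edges, and `sum_pow_card_edges_inter_le` bounds the exponential moment of that overlap by a
transfer-matrix recursion over walks. -/

namespace SimpleGraph.Walk

/-! ### Edges of self-avoiding paths. -/

variable {V : Type*} {G : SimpleGraph V}

/-- A path whose edges all belong to another path with the same endpoints equals that path. -/
theorem IsPath.eq_of_edges_subset {u v : V} {p q : G.Walk u v} (hp : p.IsPath) (hq : q.IsPath)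
    (h : p.edges ⊆ q.edges) : p = q := by
  induction p with
  | nil => exact (Walk.eq_nil_iff_nil.2 (isPath_iff_nil.1 hq)).symm
  | @cons u w v huw p ih =>
    rw [cons_isPath_iff] at hp
    cases q with
    | nil => exact absurd p.end_mem_support hp.2
    | @cons _ w' _ huw' q =>
      rw [cons_isPath_iff] at hq
      -- If `s(u, w)` occurred later in the second path, that path would revisit its start `u`;
      -- hence both begin with the same edge.
      have hw : w = w' := by
        have h1 : s(u, w) ∈ (cons huw' q).edges := h (by simp)
        rw [edges_cons, List.mem_cons] at h1
        rcases h1 with h1 | h1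
        · rcases Sym2.eq_iff.1 h1 with h2 | h2
          · exact h2.2
          · exact absurd h2.1 huw'.ne
        · exact absurd (q.fst_mem_support_of_mem_edges h1) hq.2
      subst hw
      congr 1
      refine ih hp.1 hq.1 fun e he => ?_
      have h1 : e ∈ (cons huw' q).edges := h (by simp [he])
      rw [edges_cons, List.mem_cons] at h1
      rcases h1 with h1 | h1
      · subst h1
        exact absurd (p.fst_mem_support_of_mem_edges he) hp.2
      · exact h1

/-- Every vertex is incident to at most two edges of a path, and the first vertex to at most one. -/
theorem IsPath.card_filter_mem_edges_le [DecidableEq V] {u v : V} {p : G.Walk u v}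
    (hp : p.IsPath) (T : Finset V) (x : V) :
    (T.filter fun y => s(x, y) ∈ p.edges).card ≤ 2 ∧
      (x = u → (T.filter fun y => s(x, y) ∈ p.edges).card ≤ 1) := by
  induction p with
  | nil => simp
  | @cons u w v huw p ih =>
    rw [cons_isPath_iff] at hp
    obtain ⟨ih2, ih1⟩ := ih hp.1
    have key : x = u → (T.filter fun y => s(x, y) ∈ (cons huw p).edges).card ≤ 1 := by
      rintro rfl
      refine (Finset.card_le_card (t := {w}) fun y hy => ?_).trans (by simp)
      rw [Finset.mem_filter, edges_cons, List.mem_cons] at hy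
      rcases hy.2 with h1 | h1
      · exact Finset.mem_singleton.2 (Sym2.congr_right.1 h1)
      · exact absurd (p.fst_mem_support_of_mem_edges h1) hp.2
    refine ⟨?_, key⟩
    by_cases hxu : x = u
    · exact (key hxu).trans (by norm_num)
    -- The new edge adds one at the old first vertex `w`; the sharper bound for first vertices
    -- leaves room for it.
    by_cases hxw : x = w
    · refine (Finset.card_le_card (t := insert u (T.filter fun y => s(x, y) ∈ p.edges))
        fun y hy => ?_).trans ((Finset.card_insert_le _ _).trans (Nat.succ_le_succ (ih1 hxw)))
      rw [Finset.mem_filter, edges_cons, List.mem_cons] at hy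
      rcases hy.2 with h1 | h1
      · rcases Sym2.eq_iff.1 h1 with h2 | h2
        · exact absurd h2.1 hxu
        · simp [h2.2]
      · simp [hy.1, h1]
    · refine (Finset.card_le_card fun y hy => ?_).trans ih2
      rw [Finset.mem_filter, edges_cons, List.mem_cons] at hy
      rcases hy.2 with h1 | h1
      · rcases Sym2.eq_iff.1 h1 with h2 | h2
        · exact absurd h2.1 hxu
        · exact absurd h2.1 hxw
      · simp [hy.1, h1]

end SimpleGraph.Walk

/-! ### Weighted walk sums and the overlap of paths. -/

namespace SimpleGraph

variable {V : Type*} [DecidableEq V] (G : SimpleGraph V) [G.LocallyFinite]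

/-- The sum over all walks of length `j` from `v` to `b` of the product of the weights `φ e` of
the traversed edges. -/
noncomputable def walkSum (φ : Sym2 V → ℝ) (j : ℕ) (v b : V) : ℝ :=
  ∑ q ∈ G.finsetWalkLength j v b, (q.edges.map φ).prod

theorem walkSum_zero (φ : Sym2 V → ℝ) (v b : V) :
    G.walkSum φ 0 v b = if v = b then 1 else 0 := by
  unfold walkSum finsetWalkLength
  split_ifs with h
  · subst h; simp
  · simp

theorem sum_finsetWalkLength_succ {M : Type*} [AddCommMonoid M] (j : ℕ) (v b : V)
    (f : G.Walk v b → M) :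
    ∑ q ∈ G.finsetWalkLength (j + 1) v b, f q =
      ∑ w : G.neighborSet v, ∑ q ∈ G.finsetWalkLength j w b, f (Walk.cons w.property q) := by
  rw [finsetWalkLength, Finset.sum_biUnion]
  · simp only [Finset.sum_map]
    rfl
  · intro w _ w' _ hww'
    simp only [Function.onFun, Finset.disjoint_left, Finset.mem_map]
    rintro _ ⟨q, _, rfl⟩ ⟨q', _, h⟩
    injection h with _ h1
    exact hww' (Subtype.ext h1.symm)

theorem walkSum_succ (φ : Sym2 V → ℝ) (j : ℕ) (v b : V) :
    G.walkSum φ (j + 1) v b = ∑ w ∈ G.neighborFinset v, φ s(v, w) * G.walkSum φ j w b := by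
  rw [walkSum, sum_finsetWalkLength_succ, neighborFinset,
    Finset.sum_subtype (G.neighborSet v).toFinset (fun x => Set.mem_toFinset)
      fun w => φ s(v, w) * G.walkSum φ j w b]
  exact Finset.sum_congr rfl fun w _ => by
    rw [walkSum, Finset.mul_sum]
    exact Finset.sum_congr rfl fun q _ => (List.prod_cons :
      ((s(v, (w : V)) :: q.edges).map φ).prod = _)

theorem walkSum_nonneg {φ : Sym2 V → ℝ} (hφ : ∀ e, 0 ≤ φ e) (j : ℕ) (v b : V) :
    0 ≤ G.walkSum φ j v b :=
  Finset.sum_nonneg fun q _ => List.prod_nonneg fun x hx => by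
    obtain ⟨e, _, rfl⟩ := List.mem_map.1 hx
    exact hφ e

variable {G}

theorem neighborFinset_subset_of_adj {V : Type*} {G : SimpleGraph V} [G.LocallyFinite]
    {S : Finset V} (hS : ∀ v w, G.Adj v w → w ∈ S) (v : V) : G.neighborFinset v ⊆ S := fun w hw =>
  hS v w ((G.mem_neighborFinset v w).1 hw)

theorem card_finsetWalkLength_succ_le {S : Finset V} (hS : ∀ v w, G.Adj v w → w ∈ S)
    (j : ℕ) (v b : V) :
    (G.finsetWalkLength (j + 1) v b).card ≤ S.card ^ j := by
  induction j generalizing v with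
  | zero =>
    rw [pow_zero, Finset.card_le_one]
    intro p hp q hq
    rw [mem_finsetWalkLength_iff] at hp hq
    match p, q, hp, hq with
    | .cons h .nil, .cons h' .nil, _, _ => rfl
  | succ j ih =>
    rw [Finset.card_eq_sum_ones, sum_finsetWalkLength_succ]
    simp only [← Finset.card_eq_sum_ones]
    calc _ ≤ ∑ w : G.neighborSet v, S.card ^ j := Finset.sum_le_sum fun w _ => ih _
      _ = G.degree v * S.card ^ j := by
        rw [Finset.sum_const, Finset.card_univ, card_neighborSet_eq_degree, smul_eq_mul]
      _ ≤ S.card ^ (j + 1) := by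
        rw [pow_succ']
        exact Nat.mul_le_mul_right _ (Finset.card_le_card (neighborFinset_subset_of_adj hS v))

/-- Each step applies the symmetric matrix with entries `φ s(v, w)`, whose column sums are at most
`2 * c` because a path has at most two edges at each vertex. -/
theorem sum_walkSum_path_le {S : Finset V} (hS : ∀ v w, G.Adj v w → w ∈ S)
    {a b : V} {γ : G.Walk a b} (hγ : γ.IsPath) {c : ℝ} (hc : 0 ≤ c)
    (j : ℕ) :
    ∑ v ∈ S, G.walkSum (fun e => if e ∈ γ.edges then c else 0) j v b ≤ (2 * c) ^ j := by
  set φ : Sym2 V → ℝ := fun e => if e ∈ γ.edges then c else 0 with hφ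
  have hφ0 : ∀ e, 0 ≤ φ e := fun e => by simp only [hφ]; split_ifs <;> simp [hc]
  induction j with
  | zero =>
    simp only [walkSum_zero, pow_zero, Finset.sum_ite_eq']
    split_ifs <;> norm_num
  | succ j ih =>
    calc ∑ v ∈ S, G.walkSum φ (j + 1) v b
        ≤ ∑ v ∈ S, ∑ w ∈ S, φ s(v, w) * G.walkSum φ j w b := by
          refine Finset.sum_le_sum fun v _ => ?_
          rw [walkSum_succ]
          exact Finset.sum_le_sum_of_subset_of_nonneg (neighborFinset_subset_of_adj hS v)
            fun w _ _ => mul_nonneg (hφ0 _) (G.walkSum_nonneg hφ0 _ _ _)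
      _ = ∑ w ∈ S, (∑ v ∈ S, φ s(w, v)) * G.walkSum φ j w b := by
          rw [Finset.sum_comm]
          refine Finset.sum_congr rfl fun w _ => ?_
          rw [Finset.sum_mul]
          exact Finset.sum_congr rfl fun v _ => by rw [Sym2.eq_swap]
      _ ≤ ∑ w ∈ S, 2 * c * G.walkSum φ j w b := by
          refine Finset.sum_le_sum fun w _ =>
            mul_le_mul_of_nonneg_right ?_ (G.walkSum_nonneg hφ0 _ _ _)
          simp only [hφ]
          rw [← Finset.sum_filter, Finset.sum_const, nsmul_eq_mul]
          exact mul_le_mul_of_nonneg_right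
            (by exact_mod_cast (hγ.card_filter_mem_edges_le S w).1) hc
      _ ≤ (2 * c) ^ (j + 1) := by
          rw [← Finset.mul_sum, pow_succ']
          exact mul_le_mul_of_nonneg_left ih (by positivity)

/-- Expanding the products of `1 + φ`, the difference keeps the terms with at least one factor `1`,
and this is worth a factor `1 / S.card`. The induction uses `(1 + φ) * x - φ * y = (1 + φ) * (x - y)
+ y`, the last term being controlled by `sum_walkSum_path_le`. -/
theorem walkSum_sub_walkSum_path_le {S : Finset V} (hS : ∀ v w, G.Adj v w → w ∈ S)
    {a b : V} {γ : G.Walk a b} (hγ : γ.IsPath) {c : ℝ}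
    (hc : 0 ≤ c) (j : ℕ) (v : V) :
    (S.card : ℝ) * (G.walkSum (fun e => 1 + if e ∈ γ.edges then c else 0) j v b -
      G.walkSum (fun e => if e ∈ γ.edges then c else 0) j v b) ≤
      (S.card + 2 * c) ^ j - (2 * c) ^ j := by
  set φ : Sym2 V → ℝ := fun e => if e ∈ γ.edges then c else 0 with hφ
  set n : ℝ := (S.card : ℝ)
  have hn : 0 ≤ n := Nat.cast_nonneg _
  have hφ0 : ∀ e, 0 ≤ φ e := fun e => by simp only [hφ]; split_ifs <;> simp [hc]
  have hB : ∀ j : ℕ, 0 ≤ (n + 2 * c) ^ j - (2 * c) ^ j := fun j =>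
    sub_nonneg.2 (pow_le_pow_left₀ (by positivity) (by linarith) j)
  induction j generalizing v with
  | zero => simp [walkSum_zero]
  | succ j ih =>
    have hsub := neighborFinset_subset_of_adj hS v
    have h1 : ∑ w ∈ G.neighborFinset v, G.walkSum φ j w b ≤ (2 * c) ^ j :=
      (Finset.sum_le_sum_of_subset_of_nonneg hsub
        fun w _ _ => G.walkSum_nonneg hφ0 _ _ _).trans (sum_walkSum_path_le hS hγ hc j)
    have h2 : ∑ w ∈ G.neighborFinset v, φ s(v, w) ≤ 2 * c := by
      simp only [hφ]
      rw [← Finset.sum_filter, Finset.sum_const, nsmul_eq_mul]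
      exact mul_le_mul_of_nonneg_right
        (by exact_mod_cast (hγ.card_filter_mem_edges_le _ v).1) hc
    have h3 : ((G.neighborFinset v).card : ℝ) ≤ n := Nat.cast_le.2 (Finset.card_le_card hsub)
    set B : ℝ := (n + 2 * c) ^ j - (2 * c) ^ j
    have e1 : n * (G.walkSum (fun e => 1 + φ e) (j + 1) v b - G.walkSum φ (j + 1) v b) =
        ∑ w ∈ G.neighborFinset v, ((1 + φ s(v, w)) *
          (n * (G.walkSum (fun e => 1 + φ e) j w b - G.walkSum φ j w b)) +
          n * G.walkSum φ j w b) := by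
      rw [walkSum_succ, walkSum_succ, ← Finset.sum_sub_distrib, Finset.mul_sum]
      exact Finset.sum_congr rfl fun w _ => by ring
    have e2 : ∑ w ∈ G.neighborFinset v, ((1 + φ s(v, w)) *
          (n * (G.walkSum (fun e => 1 + φ e) j w b - G.walkSum φ j w b)) +
          n * G.walkSum φ j w b) ≤
        ∑ w ∈ G.neighborFinset v, ((1 + φ s(v, w)) * B + n * G.walkSum φ j w b) :=
      Finset.sum_le_sum fun w _ => add_le_add
        (mul_le_mul_of_nonneg_left (ih w) (by linarith [hφ0 s(v, w)])) le_rfl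
    have e3 : ∑ w ∈ G.neighborFinset v, ((1 + φ s(v, w)) * B + n * G.walkSum φ j w b) =
        ((G.neighborFinset v).card + ∑ w ∈ G.neighborFinset v, φ s(v, w)) * B +
          n * ∑ w ∈ G.neighborFinset v, G.walkSum φ j w b := by
      rw [Finset.sum_add_distrib, ← Finset.sum_mul, ← Finset.mul_sum, Finset.sum_add_distrib]
      simp
    calc _ ≤ ((G.neighborFinset v).card + ∑ w ∈ G.neighborFinset v, φ s(v, w)) * B +
          n * ∑ w ∈ G.neighborFinset v, G.walkSum φ j w b := e1.le.trans (e2.trans e3.le)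
      _ ≤ (n + 2 * c) * B + n * (2 * c) ^ j :=
        add_le_add (mul_le_mul_of_nonneg_right (add_le_add h3 h2) (hB j))
          (mul_le_mul_of_nonneg_left h1 hn)
      _ = _ := by simp only [B]; ring

/-- The exponential moment of the overlap of a fixed path with the paths of the same length and
the same endpoints. -/
theorem sum_pow_card_edges_inter_le {S : Finset V} (hS : ∀ v w, G.Adj v w → w ∈ S)
    (hcard : 0 < S.card) {a b : V} {γ : G.Walk a b}
    (hγ : γ.IsPath) {c : ℝ} (hc : 0 ≤ c) :
    ∑ q ∈ G.finsetWalkLength γ.length a b with q.IsPath,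
      c ^ (q.edges.toFinset ∩ γ.edges.toFinset).card ≤
        c ^ γ.length + (S.card + 2 * c) ^ γ.length / S.card := by
  set φ : Sym2 V → ℝ := fun e => if e ∈ γ.edges then c else 0 with hφ
  have hφ0 : ∀ e, 0 ≤ φ e := fun e => by simp only [hφ]; split_ifs <;> simp [hc]
  -- A path other than `γ` has an edge off `γ`, so its `φ` product vanishes. Subtracting it is free
  -- here, and it gains the factor `1 / S.card` after summation.
  have hterm : ∀ q : G.Walk a b, q.IsPath → q ≠ γ →
      c ^ (q.edges.toFinset ∩ γ.edges.toFinset).card ≤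
        (q.edges.map fun e => 1 + φ e).prod - (q.edges.map φ).prod := by
    intro q hq hne
    have h0 : (q.edges.map φ).prod = 0 := by
      rw [List.prod_eq_zero_iff]
      by_contra hcon
      refine hne (hq.eq_of_edges_subset hγ fun e he => ?_)
      by_contra hne'
      exact hcon (List.mem_map.2 ⟨e, he, by simp [hφ, hne']⟩)
    rw [h0, sub_zero, ← List.prod_toFinset _ hq.isTrail.edges_nodup,
      ← Finset.filter_mem_eq_inter, ← Finset.prod_const, Finset.prod_filter]
    refine Finset.prod_le_prod (fun e _ => by split_ifs <;> simp [hc]) fun e _ => ?_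
    simp only [hφ, List.mem_toFinset]
    split_ifs <;> simp
  -- Nonnegativity for every walk allows the sum over paths to be enlarged to all walks.
  have hpos : ∀ q : G.Walk a b,
      0 ≤ (q.edges.map fun e => 1 + φ e).prod - (q.edges.map φ).prod := by
    intro q
    rw [sub_nonneg]
    induction q.edges with
    | nil => simp
    | cons e l ih =>
      simp only [List.map_cons, List.prod_cons]
      refine mul_le_mul (by linarith) ih (List.prod_nonneg fun x hx => ?_)
        (by linarith [hφ0 e])
      obtain ⟨e, _, rfl⟩ := List.mem_map.1 hx
      exact hφ0 e
  have hγmem : γ ∈ (G.finsetWalkLength γ.length a b).filter fun q => q.IsPath := by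
    simp [mem_finsetWalkLength_iff, hγ]
  rw [← Finset.add_sum_erase _ _ hγmem]
  refine add_le_add (le_of_eq ?_) ?_
  · rw [Finset.inter_self, List.toFinset_card_of_nodup hγ.isTrail.edges_nodup,
      Walk.length_edges]
  · calc _ ≤ ∑ q ∈ ((G.finsetWalkLength γ.length a b).filter fun q => q.IsPath).erase γ,
          ((q.edges.map fun e => 1 + φ e).prod - (q.edges.map φ).prod) := by
          refine Finset.sum_le_sum fun q hq => ?_
          rw [Finset.mem_erase, Finset.mem_filter] at hq
          exact hterm q hq.2.2 hq.1
      _ ≤ ∑ q ∈ G.finsetWalkLength γ.length a b,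
          ((q.edges.map fun e => 1 + φ e).prod - (q.edges.map φ).prod) :=
          Finset.sum_le_sum_of_subset_of_nonneg
            ((Finset.erase_subset _ _).trans (Finset.filter_subset _ _)) fun q _ _ => hpos q
      _ = G.walkSum (fun e => 1 + φ e) γ.length a b - G.walkSum φ γ.length a b := by
          rw [Finset.sum_sub_distrib, walkSum, walkSum]
      _ ≤ _ := by
          rw [le_div_iff₀' (by exact_mod_cast hcard)]
          exact (walkSum_sub_walkSum_path_le hS hγ hc _ a).trans
            (sub_le_self _ (by positivity))

end SimpleGraph

/-! ### Counting self-avoiding paths of the complete graph. -/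

namespace FPP

open SimpleGraph

noncomputable instance (n : ℕ) : (completeGraphOn n).LocallyFinite := fun v =>
  ((Set.finite_Icc 1 n).subset fun w hw => by
    exact (show (completeGraphOn n).Adj v w from hw).2.2).fintype

theorem mem_Icc_of_adj {n v w : ℕ} (h : (completeGraphOn n).Adj v w) : w ∈ Finset.Icc 1 n :=
  Finset.mem_Icc.2 h.2.2

/-- A lower bound for the number of paths of length `j + 1` which avoid a given set. -/
theorem pow_le_card_paths_avoiding (n j : ℕ) {v b : ℕ} (A : Finset ℕ) (hv : v ∈ Set.Icc 1 n)
    (hb : b ∈ Set.Icc 1 n) (hvb : v ≠ b) (hvA : v ∉ A) (hbA : b ∉ A) :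
    (n - A.card - j - 1) ^ j ≤ (((completeGraphOn n).finsetWalkLength (j + 1) v b).filter
      fun q => q.IsPath ∧ ∀ x ∈ q.support, x ∉ A).card := by
  -- `A` grows by the vertices already visited; the next vertex only has to avoid `A`, `v` and `b`.
  induction j generalizing v A with
  | zero =>
    rw [pow_zero, Nat.one_le_iff_ne_zero, Ne, Finset.card_eq_zero, ← Ne,
      ← Finset.nonempty_iff_ne_empty]
    have hadj : (completeGraphOn n).Adj v b := ⟨hvb, hv, hb⟩
    exact ⟨hadj.toWalk, by simp [mem_finsetWalkLength_iff, hvA, hbA, hvb, Adj.toWalk]⟩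
  | succ j ih =>
    set T := Finset.Icc 1 n \ (insert v (insert b A)) with hT
    have hTcard : n - A.card - 2 ≤ T.card := by
      have h1 := Finset.le_card_sdiff (insert v (insert b A)) (Finset.Icc 1 n)
      have h2 := Finset.card_insert_le v (insert b A)
      have h3 := Finset.card_insert_le b A
      rw [Nat.card_Icc] at h1
      rw [← hT] at h1
      omega
    have hadj : ∀ w ∈ T, (completeGraphOn n).Adj v w := by
      intro w hw
      rw [hT, Finset.mem_sdiff, Finset.mem_Icc] at hw
      refine ⟨?_, hv, hw.1⟩
      rintro rfl
      exact hw.2 (by simp)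
    rw [Finset.card_filter, sum_finsetWalkLength_succ]
    have hw : ∀ w : T, (n - A.card - (j + 1) - 1) ^ j ≤
        ∑ q ∈ (completeGraphOn n).finsetWalkLength (j + 1) w b,
          if (Walk.cons (hadj w w.2) q).IsPath ∧
            ∀ x ∈ (Walk.cons (hadj w w.2) q).support, x ∉ A then 1 else 0 := by
      rintro ⟨w, hw⟩
      have hwT := hw
      rw [hT, Finset.mem_sdiff, Finset.mem_Icc, Finset.mem_insert, Finset.mem_insert,
        not_or, not_or] at hw
      have h1 := ih (insert v A) hw.1 hw.2.2.1
        (by rw [Finset.mem_insert, not_or]; exact ⟨hw.2.1, hw.2.2.2⟩)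
        (by rw [Finset.mem_insert, not_or]; exact ⟨fun h => hvb h.symm, hbA⟩)
      rw [Finset.card_insert_of_notMem hvA, Finset.card_filter] at h1
      refine (Nat.pow_le_pow_left (by omega) _).trans (h1.trans (Finset.sum_le_sum fun q _ => ?_))
      by_cases hq : q.IsPath ∧ ∀ x ∈ q.support, x ∉ insert v A
      · rw [if_pos hq, if_pos]
        refine ⟨(Walk.cons_isPath_iff _ _).2 ⟨hq.1, fun h => hq.2 v h (by simp)⟩, ?_⟩
        intro x hx
        rw [Walk.support_cons, List.mem_cons] at hx
        rcases hx with rfl | hx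
        · exact hvA
        · exact fun h => hq.2 x hx (by simp [h])
      · rw [if_neg hq]; exact Nat.zero_le _
    calc (n - A.card - (j + 1) - 1) ^ (j + 1)
        ≤ T.card * (n - A.card - (j + 1) - 1) ^ j := by
          rw [pow_succ']; exact Nat.mul_le_mul_right _ (by omega)
      _ = ∑ w : T, (n - A.card - (j + 1) - 1) ^ j := by simp
      _ ≤ ∑ w : T, ∑ q ∈ (completeGraphOn n).finsetWalkLength (j + 1) w b,
          (if (Walk.cons (hadj w w.2) q).IsPath ∧
            ∀ x ∈ (Walk.cons (hadj w w.2) q).support, x ∉ A then 1 else 0) :=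
          Finset.sum_le_sum fun w _ => hw w
      _ ≤ _ := by
          let f : T → (completeGraphOn n).neighborSet v := fun w => ⟨w, hadj w w.2⟩
          have hf : Function.Injective f := fun w w' h => Subtype.ext (congrArg (fun z => z.1) h)
          let F : (completeGraphOn n).neighborSet v → ℕ := fun w =>
            ∑ q ∈ (completeGraphOn n).finsetWalkLength (j + 1) w b,
              if (Walk.cons (show (completeGraphOn n).Adj v w from w.2) q).IsPath ∧
                ∀ x ∈ (Walk.cons (show (completeGraphOn n).Adj v w from w.2) q).support, x ∉ A then 1 else 0
          exact (Finset.sum_map Finset.univ ⟨f, hf⟩ F).ge.trans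
            (Finset.sum_le_sum_of_subset (f := F) (Finset.subset_univ _))

theorem pow_le_card_paths (n j : ℕ) {a b : ℕ} (ha : a ∈ Set.Icc 1 n) (hb : b ∈ Set.Icc 1 n)
    (hab : a ≠ b) :
    (n - j - 1) ^ j ≤
      (((completeGraphOn n).finsetWalkLength (j + 1) a b).filter fun q => q.IsPath).card := by
  simpa using pow_le_card_paths_avoiding n j ∅ ha hb hab (by simp) (by simp)

instance (n a b : ℕ) : Finite (SAPath n a b) := by
  -- The start `a` is counted separately, since a trivial path may sit outside `{1, …, n}`.
  have h : ∀ p : SAPath n a b, p.1.length < n + 2 := fun p => by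
    have h1 : p.1.support.toFinset ⊆ insert a (Finset.Icc 1 n) := by
      have : ∀ (v : ℕ) (q : (completeGraphOn n).Walk v b),
          q.support.toFinset ⊆ insert v (Finset.Icc 1 n) := by
        clear * -
        intro v q
        induction q with
        | nil => simp
        | cons h q ih =>
          intro x hx
          simp only [Walk.support_cons, List.toFinset_cons, Finset.mem_insert] at hx ⊢
          rcases hx with hx | hx
          · exact Or.inl hx
          · rcases Finset.mem_insert.1 (ih hx) with rfl | h2
            · exact Or.inr (mem_Icc_of_adj h)
            · exact Or.inr h2
      exact this a p.1
    have h2 := Finset.card_le_card h1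
    rw [List.toFinset_card_of_nodup p.2.support_nodup, Walk.length_support] at h2
    have h3 := Finset.card_insert_le a (Finset.Icc 1 n)
    rw [Nat.card_Icc] at h3
    omega
  refine Finite.of_injective (β := (completeGraphOn n).finsetWalkLengthLT (n + 2) a b)
    (fun p => ⟨p.1, mem_finsetWalkLengthLT_iff.2 (h p)⟩) fun p q hpq => ?_
  exact Subtype.ext (congrArg (fun z => z.1) hpq)

theorem nonempty_SAPath {n a b : ℕ} (ha : a ∈ Set.Icc 1 n) (hb : b ∈ Set.Icc 1 n) (hab : a ≠ b) :
    Nonempty (SAPath n a b) :=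
  ⟨⟨Adj.toWalk (show (completeGraphOn n).Adj a b from ⟨hab, ha, hb⟩), by simp [hab, Adj.toWalk]⟩⟩

end FPP

/-! ### Independence, second moment method and absence of ties. -/

namespace FPP

section Probability

variable {Ω Ω₀ E : Type*} [MeasurableSpace Ω] [MeasurableSpace Ω₀] {P : Measure Ω}
  {μ : Measure Ω₀}

theorem lintegral_prod_comp_of_iid {A : Set E} {X : E → Ω → ℝ} {Y : Ω₀ → ℝ}
    (hind : iIndepFun (fun e : A => X e) P) (hlaw : ∀ e ∈ A, IdentDistrib (X e) Y P μ)
    {h : ℝ → ℝ≥0∞} (hh : Measurable h) {S : Finset E} (hS : ∀ e ∈ S, e ∈ A) :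
    ∫⁻ ω, ∏ e ∈ S, h (X e ω) ∂P = (∫⁻ ω, h (Y ω) ∂μ) ^ S.card := by
  have hm : ∀ e : S, AEMeasurable (X e) P := fun e => (hlaw e (hS e e.2)).aemeasurable_fst
  -- The variables are only almost everywhere measurable, so independence is transferred to
  -- measurable versions.
  let X' : S → Ω → ℝ := fun e => (hm e).mk (X e)
  have hind' : iIndepFun X' P := by
    let g : S → A := fun e => ⟨e, hS e e.2⟩
    have hg : Function.Injective g := fun e f h => Subtype.ext (congrArg (fun z => z.1) h)
    exact (iIndepFun_congr fun e => (hm e).ae_eq_mk).1 (iIndepFun.precomp hg hind)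
  have h1 : ∀ᵐ ω ∂P, ∀ e : S, X e ω = X' e ω := ae_all_iff.2 fun e => (hm e).ae_eq_mk
  calc ∫⁻ ω, ∏ e ∈ S, h (X e ω) ∂P = ∫⁻ ω, ∏ e ∈ (Finset.univ : Finset S), h (X' e ω) ∂P := by
        refine lintegral_congr_ae (h1.mono fun ω hω => ?_)
        simp only
        rw [← Finset.prod_coe_sort]
        exact Finset.prod_congr rfl fun e _ => by rw [hω e]
    _ = ∏ e : S, ∫⁻ ω, h (X' e ω) ∂P :=
        lintegral_prod_eq_prod_lintegral_of_indepFun _ _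
          (hind'.comp (fun _ => h) fun _ => hh) fun e => hh.comp (hm e).measurable_mk
    _ = ∏ e : S, ∫⁻ ω, h (Y ω) ∂μ := by
        refine Finset.prod_congr rfl fun e _ => ?_
        refine Eq.trans ?_ ((hlaw e (hS e e.2)).comp hh).lintegral_eq
        exact (lintegral_congr_ae ((hm e).ae_eq_mk.mono fun ω hω => by
          simp only [Function.comp]; rw [hω])).symm
    _ = _ := by simp

theorem integrable_indicator_one [IsFiniteMeasure P] {s : Set Ω} (hs : NullMeasurableSet s P) :
    Integrable (s.indicator fun _ => (1 : ℝ)) P :=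
  (integrable_const (1 : ℝ)).indicator₀ hs

theorem integral_indicator_one₀ {s : Set Ω} (hs : NullMeasurableSet s P) :
    ∫ ω, s.indicator (fun _ => (1 : ℝ)) ω ∂P = P.real s := by
  rw [integral_indicator₀ hs]; simp

variable [IsProbabilityMeasure P]

/-- The second moment method. -/
theorem sq_sum_measureReal_le {ι : Type*} (Γ : Finset ι) (A : ι → Set Ω)
    (hA : ∀ i ∈ Γ, NullMeasurableSet (A i) P) :
    (∑ i ∈ Γ, P.real (A i)) ^ 2 ≤
      P.real (⋃ i ∈ Γ, A i) * ∑ i ∈ Γ, ∑ j ∈ Γ, P.real (A i ∩ A j) := by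
  set U : Set Ω := ⋃ i ∈ Γ, A i with hU
  have hUm : NullMeasurableSet U P := Finset.nullMeasurableSet_biUnion Γ hA
  let I : Set Ω → Ω → ℝ := fun s => s.indicator fun _ => 1
  have hI : ∀ s, NullMeasurableSet s P → Integrable (I s) P := fun s => integrable_indicator_one
  have hIint : ∀ s, NullMeasurableSet s P → ∫ ω, I s ω ∂P = P.real s :=
    fun s => integral_indicator_one₀
  have hAA : ∀ i ∈ Γ, ∀ j ∈ Γ, NullMeasurableSet (A i ∩ A j) P :=
    fun i hi j hj => (hA i hi).inter (hA j hj)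
  -- Cauchy–Schwarz through a discriminant: the expectation of this square is a nonnegative
  -- quadratic in `x`. The counting sum vanishes off `U`, which simplifies the cross term.
  have hpt : ∀ (x : ℝ) (ω : Ω), (x * I U ω + ∑ i ∈ Γ, I (A i) ω) ^ 2 =
      x * x * I U ω + 2 * x * ∑ i ∈ Γ, I (A i) ω + ∑ i ∈ Γ, ∑ j ∈ Γ, I (A i ∩ A j) ω := by
    intro x ω
    have h1 : ∀ i ∈ Γ, I U ω * I (A i) ω = I (A i) ω := by
      intro i hi
      by_cases h : ω ∈ A i
      · have : ω ∈ U := Set.mem_biUnion hi h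
        simp [I, h, this]
      · simp [I, h]
    have h2 : I U ω * I U ω = I U ω := by by_cases h : ω ∈ U <;> simp [I, h]
    have h3 : ∀ i j, I (A i ∩ A j) ω = I (A i) ω * I (A j) ω := by
      intro i j
      by_cases hi : ω ∈ A i <;> by_cases hj : ω ∈ A j <;> simp [I, hi, hj]
    have h4 : I U ω * ∑ i ∈ Γ, I (A i) ω = ∑ i ∈ Γ, I (A i) ω := by
      rw [Finset.mul_sum]; exact Finset.sum_congr rfl h1
    simp only [h3, ← Finset.sum_mul_sum]
    linear_combination x * x * h2 + 2 * x * h4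
  have hint : ∀ x : ℝ, ∫ ω, (x * I U ω + ∑ i ∈ Γ, I (A i) ω) ^ 2 ∂P =
      P.real U * (x * x) + (2 * ∑ i ∈ Γ, P.real (A i)) * x +
        ∑ i ∈ Γ, ∑ j ∈ Γ, P.real (A i ∩ A j) := by
    intro x
    have i1 : Integrable (fun ω => x * x * I U ω) P := (hI U hUm).const_mul _
    have i2' : Integrable (fun ω => ∑ i ∈ Γ, I (A i) ω) P :=
      integrable_finsetSum _ fun i hi => hI _ (hA i hi)
    have i2 : Integrable (fun ω => 2 * x * ∑ i ∈ Γ, I (A i) ω) P := i2'.const_mul _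
    have i3' : ∀ i ∈ Γ, Integrable (fun ω => ∑ j ∈ Γ, I (A i ∩ A j) ω) P := fun i hi =>
      integrable_finsetSum _ fun j hj => hI _ (hAA i hi j hj)
    have i3 : Integrable (fun ω => ∑ i ∈ Γ, ∑ j ∈ Γ, I (A i ∩ A j) ω) P :=
      integrable_finsetSum _ i3'
    simp only [hpt]
    rw [integral_add (by exact i1.add i2) i3, integral_add i1 i2, integral_const_mul, integral_const_mul,
      hIint U hUm, integral_finsetSum _ fun i hi => hI _ (hA i hi), integral_finsetSum _ i3',
      Finset.sum_congr rfl fun i hi => hIint _ (hA i hi),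
      Finset.sum_congr rfl fun i hi => (integral_finsetSum _ fun j hj => hI _ (hAA i hi j hj)).trans
        (Finset.sum_congr rfl fun j hj => hIint _ (hAA i hi j hj))]
    ring
  have hd := discrim_le_zero (K := ℝ) fun x =>
    (hint x) ▸ integral_nonneg (μ := P) fun ω => sq_nonneg (x * I U ω + ∑ i ∈ Γ, I (A i) ω)
  rw [discrim] at hd
  nlinarith [hd]

/-- By independence the joint law of the sum and `X i` is a product measure, and each slice of the
diagonal is a single point, which is null for the law of `X i`. -/
theorem measure_eq_sum_mul_eq_zero {ι : Type*} {X : ι → Ω → ℝ} (hind : iIndepFun X P)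
    (hX : ∀ i, AEMeasurable (X i) P) {i : ι} (hatom : ∀ x, P {ω | X i ω = x} = 0)
    {T : Finset ι} (hi : i ∉ T) (c : ι → ℝ) :
    P {ω | X i ω = ∑ j ∈ T, c j * X j ω} = 0 := by
  classical
  -- With coefficient one at `i`, the single independent family `Y` contains `X i` along with the
  -- terms of the sum.
  let c' : ι → ℝ := fun j => if j = i then 1 else c j
  let Y : ι → Ω → ℝ := fun j ω => c' j * X j ω
  have hYm : ∀ j, AEMeasurable (Y j) P := fun j => (hX j).const_mul _
  have hY : iIndepFun Y P := hind.comp (fun j x => c' j * x) fun j => measurable_const_mul _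
  have h1 : IndepFun (∑ j ∈ T, Y j) (Y i) P := hY.indepFun_finsetSum_of_notMem₀ hYm hi
  have hYi : Y i = X i := by ext ω; simp [Y, c']
  have hYs : ∀ ω, (∑ j ∈ T, Y j) ω = ∑ j ∈ T, c j * X j ω := by
    intro ω
    rw [Finset.sum_apply]
    refine Finset.sum_congr rfl fun j hj => ?_
    have : j ≠ i := fun h => hi (h ▸ hj)
    simp [Y, c', this]
  have hsm : AEMeasurable (∑ j ∈ T, Y j) P := T.aemeasurable_sum fun j _ => hYm j
  rw [hYi] at h1
  have h2 := (indepFun_iff_map_prod_eq_prod_map_map hsm (hX i)).1 h1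
  have hD : MeasurableSet {z : ℝ × ℝ | z.2 = z.1} := measurableSet_eq_fun measurable_snd measurable_fst
  have h3 : P.map (fun ω => ((∑ j ∈ T, Y j) ω, X i ω)) {z : ℝ × ℝ | z.2 = z.1} = 0 := by
    rw [h2, Measure.measure_prod_null hD]
    refine Eventually.of_forall fun y => ?_
    change P.map (X i) (Prod.mk y ⁻¹' {z : ℝ × ℝ | z.2 = z.1}) = 0
    have : Prod.mk y ⁻¹' {z : ℝ × ℝ | z.2 = z.1} = {y} := by ext; simp
    rw [this, Measure.map_apply_of_aemeasurable (hX i) (measurableSet_singleton y)]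
    exact hatom y
  rw [Measure.map_apply_of_aemeasurable (hsm.prodMk (hX i)) hD] at h3
  simpa only [Set.preimage_ofPred_eq, hYs] using h3

end Probability

section Uniqueness

open SimpleGraph

theorem weight_eq_sum {n a b : ℕ} (x : Sym2 ℕ → ℝ) (p : SAPath n a b) :
    weight x p = ∑ e ∈ p.1.edges.toFinset, x e := by
  rw [weight, List.sum_toFinset _ p.2.isTrail.edges_nodup]

theorem exists_isOptimal {n a b : ℕ} [Nonempty (SAPath n a b)] (x : Sym2 ℕ → ℝ) :
    ∃ p : SAPath n a b, IsOptimal x p := Finite.exists_min _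

theorem minWeight_eq_of_isOptimal {n a b : ℕ} {x : Sym2 ℕ → ℝ} {p : SAPath n a b}
    (hp : IsOptimal x p) : minWeight n a b x = weight x p := by
  have : Nonempty (SAPath n a b) := ⟨p⟩
  exact le_antisymm (ciInf_le (Set.finite_range _).bddBelow p) (le_ciInf hp)

theorem exists_weight_eq_minWeight_length_eq_hopcount {n a b : ℕ} [Nonempty (SAPath n a b)]
    (x : Sym2 ℕ → ℝ) :
    ∃ p : SAPath n a b, weight x p = minWeight n a b x ∧ p.1.length = hopcount n a b x := by
  obtain ⟨p, hp⟩ := exists_isOptimal (n := n) (a := a) (b := b) x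
  obtain ⟨q, hq, hl⟩ : hopcount n a b x ∈
      {k : ℕ | ∃ p : SAPath n a b, IsOptimal x p ∧ p.1.length = k} := Nat.sInf_mem ⟨_, p, hp, rfl⟩
  exact ⟨q, (minWeight_eq_of_isOptimal hq).symm, hl⟩

variable {Ω : Type*} [MeasurableSpace Ω] {P : Measure Ω} [IsProbabilityMeasure P]

-- Two distinct paths tie only if the weight of an edge lying on just one of them equals a fixed
-- linear combination of other weights, which is a null event. There are finitely many pairs of
-- paths.
open scoped Classical in
theorem ae_existsUnique_isOptimal {n a b : ℕ} [Nonempty (SAPath n a b)] {X : Sym2 ℕ → Ω → ℝ}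
    (hind : iIndepFun (fun e : (completeGraphOn n).edgeSet => X e) P)
    (hX : ∀ e ∈ (completeGraphOn n).edgeSet, AEMeasurable (X e) P)
    (hatom : ∀ e ∈ (completeGraphOn n).edgeSet, ∀ x, P {ω | X e ω = x} = 0) :
    ∀ᵐ ω ∂P, ∃! p : SAPath n a b, IsOptimal (fun e => X e ω) p := by
  have key : ∀ p q : SAPath n a b, p ≠ q →
      ∀ᵐ ω ∂P, weight (fun e => X e ω) p ≠ weight (fun e => X e ω) q := by
    intro p q hpq
    obtain ⟨e, hep, heq⟩ : ∃ e ∈ p.1.edges, e ∉ q.1.edges := by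
      by_contra! h
      exact hpq (Subtype.ext (p.2.eq_of_edges_subset q.2 fun e he => h e he))
    set c : Sym2 ℕ → ℝ := fun f => (if f ∈ q.1.edges.toFinset then 1 else 0) -
      if f ∈ p.1.edges.toFinset then 1 else 0 with hc
    set S := (p.1.edges.toFinset ∪ q.1.edges.toFinset).erase e with hSdef
    have hS : ∀ f ∈ S, f ∈ (completeGraphOn n).edgeSet := by
      intro f hf
      rw [hSdef, Finset.mem_erase, Finset.mem_union, List.mem_toFinset, List.mem_toFinset] at hf
      exact hf.2.elim (fun h => p.1.edges_subset_edgeSet h) fun h => q.1.edges_subset_edgeSet h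
    have he : e ∈ (completeGraphOn n).edgeSet := p.1.edges_subset_edgeSet hep
    have h0 := measure_eq_sum_mul_eq_zero hind (fun f => hX f f.2) (i := ⟨e, he⟩)
      (hatom e he) (T := S.subtype (· ∈ (completeGraphOn n).edgeSet)) (by simp [hSdef])
      fun f => c f
    refine measure_mono_null (fun ω hω => ?_) h0
    simp only [ne_eq, Set.mem_compl_iff, Set.mem_ofPred_eq, not_not] at hω ⊢
    rw [Finset.sum_subtype_of_mem (fun f => c f * X f ω) hS]
    have hsum : ∑ f ∈ p.1.edges.toFinset ∪ q.1.edges.toFinset, c f * X f ω = 0 := by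
      rw [weight_eq_sum, weight_eq_sum] at hω
      simp only [hc, sub_mul, ite_mul, one_mul, zero_mul, Finset.sum_sub_distrib,
        Finset.sum_ite_mem]
      rw [Finset.union_inter_cancel_right, Finset.union_inter_cancel_left, hω, sub_self]
    rw [← Finset.add_sum_erase _ _ (show e ∈ p.1.edges.toFinset ∪ q.1.edges.toFinset by
      simp [hep])] at hsum
    have hce : c e = -1 := by simp [hc, hep, heq]
    rw [hce] at hsum
    linarith
  have key' : ∀ᵐ ω ∂P, ∀ p q : SAPath n a b, p ≠ q →
      weight (fun e => X e ω) p ≠ weight (fun e => X e ω) q := by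
    have : Countable (SAPath n a b) := Finite.to_countable
    rw [ae_all_iff]; intro p
    rw [ae_all_iff]; intro q
    by_cases h : p = q
    · simp [h]
    · exact (key p q h).mono fun ω hω _ => hω
  refine key'.mono fun ω hω => ?_
  obtain ⟨p, hp⟩ := exists_isOptimal (n := n) (a := a) (b := b) (fun e => X e ω)
  refine ⟨p, hp, fun q hq => ?_⟩
  by_contra hne
  exact hω q p hne (le_antisymm (hq p) (hp q))

end Uniqueness

end FPP

/-! ### First moment estimates for fixed `n`. -/

namespace FPP

open SimpleGraph

/-- AM–GM: the rescaled numbers have mean at most one, and `t ≤ exp (t - 1)` bounds their product by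
one. -/
theorem one_le_prod_rpow_neg {ι : Type*} {S : Finset ι} {x : ι → ℝ} (hx : ∀ i ∈ S, 0 < x i)
    {w r : ℝ} (hw : 0 < w) (hr : 0 ≤ r) (hsum : ∑ i ∈ S, x i ≤ w) :
    1 ≤ ∏ i ∈ S, (x i * (S.card / w)) ^ (-r) := by
  rcases S.eq_empty_or_nonempty with rfl | hS
  · simp
  have hc : (0 : ℝ) < S.card := by exact_mod_cast hS.card_pos
  have hpos : ∀ i ∈ S, 0 < x i * (S.card / w) := fun i hi => by have := hx i hi; positivity
  rw [Real.finsetProd_rpow _ _ fun i hi => (hpos i hi).le]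
  refine Real.one_le_rpow_of_pos_of_le_one_of_nonpos (Finset.prod_pos hpos) ?_ (by linarith)
  calc ∏ i ∈ S, (x i * (S.card / w)) ≤ ∏ i ∈ S, Real.exp (x i * (S.card / w) - 1) :=
        Finset.prod_le_prod (fun i hi => (hpos i hi).le) fun i _ => by
          linarith [Real.add_one_le_exp (x i * (S.card / w) - 1)]
    _ = Real.exp ((∑ i ∈ S, x i) * (S.card / w) - S.card) := by
        rw [← Real.exp_sum, Finset.sum_sub_distrib, Finset.sum_mul]; simp
    _ ≤ 1 := by
        rw [Real.exp_le_one_iff, sub_nonpos]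
        calc (∑ i ∈ S, x i) * (S.card / w) ≤ w * (S.card / w) :=
              mul_le_mul_of_nonneg_right hsum (by positivity)
          _ = S.card := by field_simp

section Path

variable {Ω Ω₀ : Type*} [MeasurableSpace Ω] [MeasurableSpace Ω₀] {P : Measure Ω} {μ : Measure Ω₀}
  {n a b : ℕ} {X : Sym2 ℕ → Ω → ℝ} {Y : Ω₀ → ℝ}

/-- On this event the product in `one_le_prod_rpow_neg` is at least one; Markov's inequality
applies, and independence factorises the expectation. -/
theorem measure_weight_le_le
    (hind : iIndepFun (fun e : (completeGraphOn n).edgeSet => X e) P)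
    (hlaw : ∀ e ∈ (completeGraphOn n).edgeSet, IdentDistrib (X e) Y P μ)
    (hYpos : ∀ᵐ ω ∂μ, 0 < Y ω) {r w : ℝ} (hr : 0 ≤ r) (hw : 0 < w)
    (p : SAPath n a b) (hp : 0 < p.1.length) :
    P {ω | weight (fun e => X e ω) p ≤ w} ≤
      (ENNReal.ofReal ((w / p.1.length) ^ r) * ∫⁻ ω, ENNReal.ofReal (Y ω ^ (-r)) ∂μ) ^
        p.1.length := by
  set S := p.1.edges.toFinset with hS
  have hSA : ∀ e ∈ S, e ∈ (completeGraphOn n).edgeSet := fun e he =>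
    p.1.edges_subset_edgeSet (List.mem_toFinset.1 he)
  have hcard : S.card = p.1.length := by
    rw [hS, List.toFinset_card_of_nodup p.2.isTrail.edges_nodup, Walk.length_edges]
  have hk : (0 : ℝ) < p.1.length := by exact_mod_cast hp
  set h : ℝ → ℝ≥0∞ := fun x => ENNReal.ofReal ((x * (S.card / w)) ^ (-r)) with hh
  have hm : Measurable h := by fun_prop
  have hpos : ∀ᵐ ω ∂P, ∀ e ∈ S, 0 < X e ω := by
    refine (ae_ball_iff S.countable_toSet).2 fun e he => ?_
    exact (hlaw e (hSA e he)).symm.ae_snd measurableSet_Ioi hYpos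
  calc P {ω | weight (fun e => X e ω) p ≤ w}
      ≤ ∫⁻ ω, ∏ e ∈ S, h (X e ω) ∂P := by
        refine (measure_mono_ae (t := {ω | 1 ≤ ∏ e ∈ S, h (X e ω)})
          (hpos.mono fun ω hω hwt => ?_)).trans ?_
        · change 1 ≤ ∏ e ∈ S, h (X e ω)
          replace hwt : weight (fun e => X e ω) p ≤ w := hwt
          rw [weight_eq_sum] at hwt
          simp only [hh]
          rw [← ENNReal.ofReal_prod_of_nonneg fun e he => by
            have := hω e he
            positivity]
          rw [ENNReal.one_le_ofReal]
          exact one_le_prod_rpow_neg hω hw hr hwt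
        · have hae : AEMeasurable (fun ω => ∏ e ∈ S, h (X e ω)) P :=
            Finset.aemeasurable_fun_prod S fun e he =>
              hm.comp_aemeasurable (hlaw e (hSA e he)).aemeasurable_fst
          simpa using mul_meas_ge_le_lintegral₀ hae 1
    _ = (∫⁻ ω, h (Y ω) ∂μ) ^ p.1.length := by
        rw [lintegral_prod_comp_of_iid hind hlaw hm hSA, hcard]
    _ = _ := by
        congr 1
        rw [← lintegral_const_mul' _ _ ENNReal.ofReal_ne_top]
        refine lintegral_congr_ae (hYpos.mono fun ω hω => ?_)
        simp only [hh]
        rw [← ENNReal.ofReal_mul (by positivity), hcard, Real.mul_rpow hω.le (by positivity),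
          Real.rpow_neg (by positivity : (0 : ℝ) ≤ p.1.length / w), ← Real.inv_rpow (by positivity),
          inv_div, mul_comm]

/-- Union bound. A path of length `j + 1` has `j` free interior vertices, whence `n ^ j`, and the
factors `(1 / 2) ^ (j + 1)` sum to one over all lengths. -/
theorem measure_exists_path_le (hab : a ≠ b)
    (hind : iIndepFun (fun e : (completeGraphOn n).edgeSet => X e) P)
    (hlaw : ∀ e ∈ (completeGraphOn n).edgeSet, IdentDistrib (X e) Y P μ)
    (hYpos : ∀ᵐ ω ∂μ, 0 < Y ω) {r w m η : ℝ} (hr : 0 ≤ r) (hw : 0 < w)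
    (hm : ∫⁻ ω, ENNReal.ofReal (Y ω ^ (-r)) ∂μ ≤ ENNReal.ofReal m) (hm0 : 0 ≤ m) (A : Set ℕ)
    (h : ∀ j : ℕ, j + 1 ∈ A →
      (n : ℝ) ^ j * ((w / (j + 1 : ℕ)) ^ r * m) ^ (j + 1) ≤ η * (1 / 2) ^ (j + 1)) :
    P {ω | ∃ p : SAPath n a b, p.1.length ∈ A ∧ weight (fun e => X e ω) p ≤ w} ≤
      ENNReal.ofReal η := by
  let B : ∀ j : ℕ, (completeGraphOn n).Walk a b → Set Ω := fun j q =>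
    {ω | j + 1 ∈ A ∧ ∃ hq : q.IsPath, weight (fun e => X e ω) (⟨q, hq⟩ : SAPath n a b) ≤ w}
  have hB : ∀ (j : ℕ) (q : (completeGraphOn n).Walk a b),
      q ∈ (completeGraphOn n).finsetWalkLength (j + 1) a b → j + 1 ∈ A →
        P (B j q) ≤ ENNReal.ofReal (((w / (j + 1 : ℕ)) ^ r * m) ^ (j + 1)) := by
    intro j q hq _
    rw [mem_finsetWalkLength_iff] at hq
    by_cases hqp : q.IsPath
    · refine (measure_mono (t := {ω | weight (fun e => X e ω) (⟨q, hqp⟩ : SAPath n a b) ≤ w})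
        fun ω hω => hω.2.2).trans ?_
      refine (measure_weight_le_le hind hlaw hYpos hr hw ⟨q, hqp⟩ (by simp [hq])).trans ?_
      simp only [hq]
      rw [ENNReal.ofReal_pow (by positivity), ENNReal.ofReal_mul (by positivity)]
      gcongr
    · have : B j q = ∅ := Set.eq_empty_of_forall_notMem fun ω hω => hqp hω.2.1
      rw [this, measure_empty]
      exact zero_le
  calc _ ≤ P (⋃ j : ℕ, ⋃ q ∈ (completeGraphOn n).finsetWalkLength (j + 1) a b, B j q) := by
        refine measure_mono ?_
        rintro ω ⟨p, hpA, hpw⟩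
        have hpos : 0 < p.1.length := Nat.pos_of_ne_zero fun h0 =>
          hab (Walk.eq_of_length_eq_zero h0)
        obtain ⟨j, hj⟩ := Nat.exists_eq_add_of_lt hpos
        rw [zero_add] at hj
        simp only [Set.mem_iUnion]
        exact ⟨j, p.1, mem_finsetWalkLength_iff.2 hj, hj ▸ hpA, p.2, hpw⟩
    _ ≤ ∑' j : ℕ, P (⋃ q ∈ (completeGraphOn n).finsetWalkLength (j + 1) a b, B j q) :=
        measure_iUnion_le _
    _ ≤ ∑' j : ℕ, ENNReal.ofReal η * 2⁻¹ ^ (j + 1) := by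
        refine ENNReal.tsum_le_tsum fun j => ?_
        by_cases hjA : j + 1 ∈ A
        · refine (measure_biUnion_finset_le _ _).trans ((Finset.sum_le_sum fun q hq =>
            hB j q hq hjA).trans ?_)
          rw [Finset.sum_const, nsmul_eq_mul]
          have hcard : (((completeGraphOn n).finsetWalkLength (j + 1) a b).card : ℝ≥0∞) ≤
              ENNReal.ofReal ((n : ℝ) ^ j) := by
            rw [ENNReal.ofReal_pow (by positivity), ENNReal.ofReal_natCast]
            have := card_finsetWalkLength_succ_le (G := completeGraphOn n) (S := Finset.Icc 1 n)
              (fun v w => mem_Icc_of_adj) j a b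
            rw [Nat.card_Icc, Nat.add_sub_cancel] at this
            exact_mod_cast this
          have h2 : (2⁻¹ : ℝ≥0∞) = ENNReal.ofReal (1 / 2) := by
            rw [one_div, ENNReal.ofReal_inv_of_pos two_pos]; simp
          refine (mul_le_mul_left hcard _).trans ?_
          rw [← ENNReal.ofReal_mul (by positivity), h2, ← ENNReal.ofReal_pow (by positivity),
            ← ENNReal.ofReal_mul' (by positivity)]
          exact ENNReal.ofReal_le_ofReal (h j hjA)
        · have : (⋃ q ∈ (completeGraphOn n).finsetWalkLength (j + 1) a b, B j q) = ∅ := by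
            simp only [Set.iUnion_eq_empty]
            exact fun q _ => Set.eq_empty_of_forall_notMem fun ω hω => hjA hω.1
          rw [this, measure_empty]
          exact zero_le
    _ = ENNReal.ofReal η := by
        rw [ENNReal.tsum_mul_left, ENNReal.tsum_geometric_add_one, ENNReal.one_sub_inv_two,
          inv_inv, ENNReal.inv_mul_cancel (by simp) (by simp), mul_one]

end Path

/-- Layer cake: heights up to one contribute at most one. At height `t > 1` the level set is `Z ≤ t
^ (-θ⁻¹)`, of probability at most `C * t ^ (-θ⁻¹)`, which is integrable as `θ < 1`. -/
theorem lintegral_rpow_neg_le {Ω₀ : Type*} [MeasurableSpace Ω₀] {μ : Measure Ω₀}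
    [IsProbabilityMeasure μ] {Z : Ω₀ → ℝ} (hZ : Measurable Z) (hZpos : ∀ᵐ ω ∂μ, 0 < Z ω)
    {C : ℝ} (hC : ∀ x, 0 < x → μ.real {ω | Z ω ≤ x} ≤ C * x) {θ : ℝ} (h0 : 0 < θ) (h1 : θ < 1) :
    ∫⁻ ω, ENNReal.ofReal (Z ω ^ (-θ)) ∂μ ≤ ENNReal.ofReal (1 + C * (θ / (1 - θ))) := by
  have hC0 : 0 ≤ C := by simpa using measureReal_nonneg.trans (hC 1 one_pos)
  rw [lintegral_eq_lintegral_meas_le μ (hZpos.mono fun ω hω => by positivity)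
    (by fun_prop), ← Set.Ioc_union_Ioi_eq_Ioi zero_le_one,
    lintegral_union measurableSet_Ioi (Set.Ioc_disjoint_Ioi le_rfl),
    ENNReal.ofReal_add zero_le_one (by have : 0 < 1 - θ := by linarith
                                       positivity)]
  refine add_le_add ?_ ?_
  · calc ∫⁻ t in Set.Ioc 0 1, μ {ω | t ≤ Z ω ^ (-θ)} ≤ ∫⁻ t in Set.Ioc (0 : ℝ) 1, 1 :=
          lintegral_mono fun t => prob_le_one
      _ = ENNReal.ofReal 1 := by simp
  · have hlt : -θ⁻¹ < -1 := by
      have := (one_lt_inv₀ h0).2 h1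
      linarith
    have hval : ∫ t in Set.Ioi (1 : ℝ), C * t ^ (-θ⁻¹) = C * (θ / (1 - θ)) := by
      rw [integral_const_mul, integral_Ioi_rpow_of_lt hlt one_pos, Real.one_rpow]
      have h2 : -θ⁻¹ + 1 ≠ 0 := by linarith
      have h3 : 1 - θ ≠ 0 := by linarith
      congr 1
      rw [div_eq_div_iff h2 h3]
      field_simp
      ring
    have hint : IntegrableOn (fun t : ℝ => C * t ^ (-θ⁻¹)) (Set.Ioi 1) :=
      (integrableOn_Ioi_rpow_of_lt hlt one_pos).const_mul C
    rw [← hval, ofReal_integral_eq_lintegral_ofReal hint]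
    · refine lintegral_mono_ae ((ae_restrict_iff' measurableSet_Ioi).2
        (Eventually.of_forall fun t ht => ?_))
      have ht0 : (0 : ℝ) < t := one_pos.trans ht
      calc μ {ω | t ≤ Z ω ^ (-θ)} ≤ μ {ω | Z ω ≤ t ^ (-θ⁻¹)} := by
            refine measure_mono_ae (hZpos.mono fun ω hω h => ?_)
            change Z ω ≤ t ^ (-θ⁻¹)
            replace h : t ≤ Z ω ^ (-θ) := h
            calc Z ω = (Z ω ^ (-θ)) ^ (-θ⁻¹) := by
                  rw [← Real.rpow_mul hω.le, neg_mul_neg, mul_inv_cancel₀ h0.ne', Real.rpow_one]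
              _ ≤ t ^ (-θ⁻¹) := Real.rpow_le_rpow_of_nonpos ht0 h (by
                  have := inv_pos.2 h0
                  linarith)
        _ = ENNReal.ofReal (μ.real {ω | Z ω ≤ t ^ (-θ⁻¹)}) := by
            rw [ofReal_measureReal]
        _ ≤ _ := ENNReal.ofReal_le_ofReal (hC _ (by positivity))
    · exact (ae_restrict_iff' measurableSet_Ioi).2 (Eventually.of_forall fun t ht => by
        have ht0 : (0 : ℝ) < t := one_pos.trans ht
        simp only [Pi.zero_apply]
        positivity)

end FPP

namespace FPP

/-- The first moment bound for the existence of light paths with a prescribed set of lengths. -/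
theorem measure_exists_path_le_exp {Ω Ω₀ : Type*} [MeasurableSpace Ω] [MeasurableSpace Ω₀]
    {P : Measure Ω} {μ : Measure Ω₀} [IsProbabilityMeasure μ]
    {n a b : ℕ} {X : Sym2 ℕ → Ω → ℝ} {Z : Ω₀ → ℝ} {s C u w M : ℝ} (hab : a ≠ b)
    (hind : iIndepFun (fun e : (completeGraphOn n).edgeSet => X e) P)
    (hlaw : ∀ e ∈ (completeGraphOn n).edgeSet, IdentDistrib (X e) (fun ω => Z ω ^ s) P μ)
    (hZ : Measurable Z) (hZpos : ∀ᵐ ω ∂μ, 0 < Z ω)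
    (hC1 : 1 ≤ C) (hC : ∀ x, 0 < x → μ.real {ω | Z ω ≤ x} ≤ C * x)
    (hs : 0 < s) (hn : 2 ≤ Real.log n) (hu : 0 < u) (hun : u ^ (1 / s) ≤ C / n)
    (hw : 0 < w) (hM0 : 0 ≤ M) (A : Set ℕ)
    (hM : ∀ k ∈ A, 0 < k → (k : ℝ) *
      Real.log (w * Real.exp (2 * s * Real.log (4 * Real.exp 1 * C ^ 2 * Real.log n)) / k) ≤ M) :
    P {ω | ∃ p : SAPath n a b, p.1.length ∈ A ∧ weight (fun e => X e ω) p ≤ w * u} ≤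
      ENNReal.ofReal (Real.exp (-Real.log n + M / s)) := by
  set L := Real.log n with hL
  -- `D * L` collects the losses per edge: `C * exp 1` from `u ^ r`, `2 * C * L` from the moment,
  -- and `2` for the geometric series.
  set D := 4 * Real.exp 1 * C ^ 2 with hD
  -- Inflating `w` by `exp ν` absorbs `D * L`, because `r * ν = 2 * θ * log (D * L)` and `θ ≥ 1 /
  -- 2`.
  set ν := 2 * s * Real.log (D * L) with hν
  have hL0 : 0 < L := by linarith
  have hn0 : (0 : ℝ) < n := by
    rcases Nat.eq_zero_or_pos n with h | h
    · rw [hL, h] at hn; norm_num at hn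
    · exact_mod_cast h
  have hnexp : (n : ℝ) = Real.exp L := (Real.exp_log hn0).symm
  set θ := 1 - 1 / L with hθ
  have hLinv : 1 / L ≤ 1 / 2 := one_div_le_one_div_of_le two_pos hn
  have hLinv0 : 0 < 1 / L := by positivity
  have hθ0 : 1 / 2 ≤ θ := by linarith
  have hθ1 : θ < 1 := by linarith
  have he : 1 ≤ Real.exp 1 := Real.one_le_exp zero_le_one
  have hDL1 : 1 ≤ D * L := by
    have h1 : 1 ≤ C ^ 2 := one_le_pow₀ hC1
    have h2 : 1 ≤ 4 * Real.exp 1 := by linarith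
    have h3 : 1 ≤ D := one_le_mul_of_one_le_of_one_le h2 h1
    exact one_le_mul_of_one_le_of_one_le h3 (by linarith)
  have hlogDL : 0 ≤ Real.log (D * L) := Real.log_nonneg hDL1
  set r := θ / s with hr
  have hr0 : 0 < r := by have : 0 < θ := by linarith
                         positivity
  have hYpos : ∀ᵐ ω ∂μ, 0 < Z ω ^ s := hZpos.mono fun ω hω => Real.rpow_pos_of_pos hω s
  have hm : ∫⁻ ω, ENNReal.ofReal ((Z ω ^ s) ^ (-r)) ∂μ ≤ ENNReal.ofReal (2 * C * L) := by
    have h1 := lintegral_rpow_neg_le hZ hZpos hC (θ := θ) (by linarith) hθ1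
    refine (le_of_eq (lintegral_congr_ae (hZpos.mono fun ω hω => ?_))).trans
      (h1.trans (ENNReal.ofReal_le_ofReal ?_))
    · rw [← Real.rpow_mul hω.le, hr]
      congr 2
      field_simp
    · have h2 : θ / (1 - θ) = L - 1 := by
        rw [hθ]; field_simp; ring
      rw [h2]
      nlinarith
  have hur : u ^ r ≤ C * Real.exp 1 / n := by
    calc u ^ r = (u ^ (1 / s)) ^ θ := by
          rw [← Real.rpow_mul hu.le, hr]; congr 1; ring
      _ ≤ (C / n) ^ θ := Real.rpow_le_rpow (by positivity) hun (by linarith)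
      _ = C ^ θ / (n : ℝ) ^ θ := Real.div_rpow (by linarith) hn0.le _
      _ ≤ C / (n : ℝ) ^ θ := by
          have : C ^ θ ≤ C ^ (1 : ℝ) := Real.rpow_le_rpow_of_exponent_le hC1 hθ1.le
          rw [Real.rpow_one] at this
          gcongr
      _ = C * Real.exp 1 / n := by
          have : (n : ℝ) ^ θ = n / Real.exp 1 := by
            rw [Real.rpow_def_of_pos hn0, ← hL, hnexp, ← Real.exp_sub, hθ]
            congr 1
            field_simp
          rw [this]
          field_simp
  refine measure_exists_path_le hab hind hlaw hYpos hr0.le (mul_pos hw hu) hm (by positivity) A ?_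
  intro j hj
  have hk0 : (0 : ℝ) < (j + 1 : ℕ) := by positivity
  have hMk := hM (j + 1) hj (Nat.succ_pos j)
  set k : ℝ := ((j + 1 : ℕ) : ℝ)
  have h1 : (w * u / k) ^ r * (2 * C * L) ≤ Real.exp (r * Real.log (w * Real.exp ν / k)) / (2 * n) := by
    have e1 : (w * u / k) ^ r = (w / k) ^ r * u ^ r := by
      rw [← Real.mul_rpow (by positivity) hu.le]; congr 1; ring
    have e2 : (w / k) ^ r * (D * L) ≤ Real.exp (r * Real.log (w * Real.exp ν / k)) := by
      have e3 : Real.log (w * Real.exp ν / k) = Real.log (w / k) + ν := by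
        rw [show w * Real.exp ν / k = w / k * Real.exp ν by ring,
          Real.log_mul (by positivity) (by positivity), Real.log_exp]
      rw [e3, Real.rpow_def_of_pos (by positivity : 0 < w / k), mul_add, Real.exp_add,
        mul_comm (Real.log (w / k))]
      refine mul_le_mul_of_nonneg_left ?_ (Real.exp_nonneg _)
      rw [← Real.log_le_iff_le_exp (by linarith)]
      have : r * ν = 2 * θ * Real.log (D * L) := by rw [hr, hν]; field_simp
      rw [this]
      nlinarith
    calc (w * u / k) ^ r * (2 * C * L) ≤ (w / k) ^ r * (C * Real.exp 1 / n) * (2 * C * L) := by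
          rw [e1]; gcongr
      _ = (w / k) ^ r * (D * L) / (2 * n) := by rw [hD]; field_simp; ring
      _ ≤ _ := by gcongr
  calc (n : ℝ) ^ j * ((w * u / k) ^ r * (2 * C * L)) ^ (j + 1)
      ≤ (n : ℝ) ^ j * (Real.exp (r * Real.log (w * Real.exp ν / k)) / (2 * n)) ^ (j + 1) := by
        gcongr
    _ = Real.exp (r * (k * Real.log (w * Real.exp ν / k))) / n * (1 / 2) ^ (j + 1) := by
        have : Real.exp (r * (k * Real.log (w * Real.exp ν / k))) =
            Real.exp (r * Real.log (w * Real.exp ν / k)) ^ (j + 1) := by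
          rw [← Real.exp_nat_mul]; congr 1; simp only [k]; ring
        rw [this, div_pow, mul_pow, div_pow, one_pow, pow_succ (n : ℝ)]
        field_simp
    _ ≤ Real.exp (-L + M / s) * (1 / 2) ^ (j + 1) := by
        refine mul_le_mul_of_nonneg_right ?_ (by positivity)
        rw [Real.exp_add, Real.exp_neg, ← hnexp, div_eq_inv_mul]
        refine mul_le_mul_of_nonneg_left (Real.exp_le_exp.2 ?_) (by positivity)
        calc r * (k * Real.log (w * Real.exp ν / k)) ≤ r * M := by gcongr
          _ ≤ M / s := by
            rw [hr, div_mul_eq_mul_div]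
            gcongr
            nlinarith

end FPP

/-! ### Second moment estimate for fixed `n`. -/

namespace FPP

open SimpleGraph

section SecondMoment

variable {Ω Ω₀ : Type*} [MeasurableSpace Ω] [MeasurableSpace Ω₀] {P : Measure Ω}
  [IsProbabilityMeasure P] {μ : Measure Ω₀}
  {n a b : ℕ} {X : Sym2 ℕ → Ω → ℝ} {Y : Ω₀ → ℝ}

theorem measureReal_forall_le {E : Type*} {A : Set E} {X : E → Ω → ℝ}
    (hind : iIndepFun (fun e : A => X e) P) (hlaw : ∀ e ∈ A, IdentDistrib (X e) Y P μ)
    {S : Finset E} (hS : ∀ e ∈ S, e ∈ A) (T : ℝ) :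
    P.real {ω | ∀ e ∈ S, X e ω ≤ T} = μ.real {ω | Y ω ≤ T} ^ S.card := by
  rcases S.eq_empty_or_nonempty with rfl | ⟨e₀, he₀⟩
  · simp
  have hY : AEMeasurable Y μ := (hlaw e₀ (hS e₀ he₀)).aemeasurable_snd
  have hm : Measurable ((Set.Iic T).indicator (fun _ => (1 : ℝ≥0∞))) :=
    measurable_const.indicator measurableSet_Iic
  have h1 := lintegral_prod_comp_of_iid hind hlaw hm hS
  have hnull : NullMeasurableSet {ω | ∀ e ∈ S, X e ω ≤ T} P := by
    have : {ω | ∀ e ∈ S, X e ω ≤ T} = ⋂ e ∈ S, {ω | X e ω ≤ T} := by ext; simp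
    rw [this]
    exact Finset.nullMeasurableSet_biInter S fun e he =>
      nullMeasurableSet_le (hlaw e (hS e he)).aemeasurable_fst aemeasurable_const
  have h2 : ∫⁻ ω, ∏ e ∈ S, (Set.Iic T).indicator (fun _ => (1 : ℝ≥0∞)) (X e ω) ∂P =
      P {ω | ∀ e ∈ S, X e ω ≤ T} := by
    rw [← lintegral_indicator_one₀ hnull]
    refine lintegral_congr fun ω => ?_
    by_cases h : ω ∈ {ω | ∀ e ∈ S, X e ω ≤ T}
    · rw [Set.indicator_of_mem h]
      exact Finset.prod_eq_one fun e he => Set.indicator_of_mem (Set.mem_Iic.2 (h e he)) _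
    · rw [Set.indicator_of_notMem h]
      simp only [Set.mem_ofPred_eq, not_forall] at h
      obtain ⟨e, he, hne⟩ := h
      exact Finset.prod_eq_zero he (Set.indicator_of_notMem (fun h => hne (Set.mem_Iic.1 h)) _)
  have h3 : ∫⁻ ω, (Set.Iic T).indicator (fun _ => (1 : ℝ≥0∞)) (Y ω) ∂μ = μ {ω | Y ω ≤ T} := by
    rw [← lintegral_indicator_one₀ (nullMeasurableSet_le hY aemeasurable_const)]
    rfl
  rw [h2, h3] at h1
  rw [measureReal_def, h1, ENNReal.toReal_pow, measureReal_def]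

/-- A second moment bound for the existence of paths of length `k` and weight at most `v`. -/
theorem second_moment_bound [IsProbabilityMeasure μ] (hn : 0 < n)
    (hind : iIndepFun (fun e : (completeGraphOn n).edgeSet => X e) P)
    (hlaw : ∀ e ∈ (completeGraphOn n).edgeSet, IdentDistrib (X e) Y P μ) (hY : AEMeasurable Y μ)
    {T T' v : ℝ} (hT : T' ≤ T) (hp : 0 < μ.real {ω | Y ω ≤ T})
    (hl : μ.real {ω | T' < Y ω ∧ Y ω ≤ T} ≤ μ.real {ω | Y ω ≤ T} / 16) (k : ℕ)
    (hv : k * T - k / 2 * (T - T') ≤ v) :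
    (1 - (1 / 2) ^ k) ^ 2 *
      (((completeGraphOn n).finsetWalkLength k a b).filter fun q => q.IsPath).card ≤
      P.real {ω | ∃ p : SAPath n a b, weight (fun e => X e ω) p ≤ v} *
        ((1 / μ.real {ω | Y ω ≤ T}) ^ k + (n + 2 * (1 / μ.real {ω | Y ω ≤ T})) ^ k / n) := by
  set p := μ.real {ω | Y ω ≤ T} with hpdef
  set Γ := ((completeGraphOn n).finsetWalkLength k a b).filter fun q => q.IsPath with hΓ
  -- `h` is `1` up to `T'` and `16` on the top layer, so its mean is at most `p + 15 * p / 16 ≤ 2 *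
  -- p`. More than half of the edges in the layer would make the product at least `4 ^ k`, which by
  -- Markov's inequality has probability at most `(p / 2) ^ k`.
  set h : ℝ → ℝ≥0∞ := fun x =>
    (Set.Iic T).indicator (fun _ => 1) x + (Set.Ioc T' T).indicator (fun _ => 15) x with hh
  have hhm : Measurable h := (measurable_const.indicator measurableSet_Iic).add
    (measurable_const.indicator measurableSet_Ioc)
  let S : (completeGraphOn n).Walk a b → Finset (Sym2 ℕ) := fun q => q.edges.toFinset
  have hSA : ∀ q : (completeGraphOn n).Walk a b, ∀ e ∈ S q, e ∈ (completeGraphOn n).edgeSet :=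
    fun q e he => q.edges_subset_edgeSet (List.mem_toFinset.1 he)
  have hScard : ∀ q ∈ Γ, (S q).card = k := by
    intro q hq
    rw [hΓ, Finset.mem_filter, mem_finsetWalkLength_iff] at hq
    rw [List.toFinset_card_of_nodup hq.2.isTrail.edges_nodup, Walk.length_edges, hq.1]
  let B : (completeGraphOn n).Walk a b → Set Ω := fun q => {ω | ∀ e ∈ S q, X e ω ≤ T}
  let D : (completeGraphOn n).Walk a b → Set Ω := fun q => {ω | 4 ^ k ≤ ∏ e ∈ S q, h (X e ω)}
  have hDm : ∀ q, NullMeasurableSet (D q) P := fun q =>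
    nullMeasurableSet_le aemeasurable_const (Finset.aemeasurable_fun_prod _ fun e he =>
      hhm.comp_aemeasurable (hlaw e (hSA q e he)).aemeasurable_fst)
  have hBm : ∀ q, NullMeasurableSet (B q) P := fun q => by
    have : B q = ⋂ e ∈ S q, {ω | X e ω ≤ T} := by ext; simp [B]
    rw [this]
    exact Finset.nullMeasurableSet_biInter _ fun e he =>
      nullMeasurableSet_le (hlaw e (hSA q e he)).aemeasurable_fst aemeasurable_const
  have hhint : ∫⁻ ω, h (Y ω) ∂μ ≤ ENNReal.ofReal (2 * p) := by
    have m1 : NullMeasurableSet {ω | Y ω ≤ T} μ := nullMeasurableSet_le hY aemeasurable_const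
    have m2 : NullMeasurableSet {ω | T' < Y ω ∧ Y ω ≤ T} μ :=
      (nullMeasurableSet_lt aemeasurable_const hY).inter m1
    have e1 : ∫⁻ ω, h (Y ω) ∂μ = μ {ω | Y ω ≤ T} + 15 * μ {ω | T' < Y ω ∧ Y ω ≤ T} := by
      rw [← one_mul (μ {ω | Y ω ≤ T}), ← lintegral_indicator_const₀ m1,
        ← lintegral_indicator_const₀ m2, ← lintegral_add_left' (aemeasurable_const.indicator₀ m1)]
      rfl
    rw [e1, ← ofReal_measureReal, ← ofReal_measureReal, ← hpdef,
      show (15 : ℝ≥0∞) = ENNReal.ofReal 15 by simp, ← ENNReal.ofReal_mul (by norm_num),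
      ← ENNReal.ofReal_add hp.le (by positivity)]
    exact ENNReal.ofReal_le_ofReal (by linarith)
  have hD : ∀ q ∈ Γ, P.real (D q) ≤ (p / 2) ^ k := by
    intro q hq
    have h1 := mul_meas_ge_le_lintegral₀ (μ := P) (f := fun ω => ∏ e ∈ S q, h (X e ω))
      (Finset.aemeasurable_fun_prod _ fun e he =>
      hhm.comp_aemeasurable (hlaw e (hSA q e he)).aemeasurable_fst) (4 ^ k)
    rw [lintegral_prod_comp_of_iid hind hlaw hhm (hSA q), hScard q hq] at h1
    have h2 : (4 : ℝ≥0∞) ^ k * P (D q) ≤ ENNReal.ofReal ((2 * p) ^ k) := by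
      rw [ENNReal.ofReal_pow (by positivity)]
      exact h1.trans (pow_le_pow_left' hhint k)
    have h3 := ENNReal.toReal_mono ENNReal.ofReal_ne_top h2
    rw [ENNReal.toReal_ofReal (by positivity), ENNReal.toReal_mul, ENNReal.toReal_pow] at h3
    have h4 : (4 : ℝ) ^ k * P.real (D q) ≤ (2 * p) ^ k := by simpa [measureReal_def] using h3
    have h5 : (2 * p) ^ k = 4 ^ k * (p / 2) ^ k := by rw [← mul_pow]; congr 1; ring
    rw [h5] at h4
    exact le_of_mul_le_mul_left h4 (by positivity)
  let A : (completeGraphOn n).Walk a b → Set Ω := fun q => B q \ D q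
  have hAm : ∀ q ∈ Γ, NullMeasurableSet (A q) P := fun q _ => (hBm q).diff (hDm q)
  have hA : ∀ q ∈ Γ, p ^ k * (1 - (1 / 2) ^ k) ≤ P.real (A q) := by
    intro q hq
    have h1 : P.real (B q) = p ^ k := by
      rw [measureReal_forall_le hind hlaw (hSA q) T, hScard q hq]
    have h2 : P.real (B q) ≤ P.real (A q) + P.real (D q) :=
      (measureReal_mono (fun ω hω => by
        by_cases hd : ω ∈ D q
        · exact Or.inr hd
        · exact Or.inl ⟨hω, hd⟩)).trans (measureReal_union_le _ _)
    have h3 := hD q hq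
    rw [show p / 2 = p * (1 / 2) by ring, mul_pow] at h3
    linarith
  -- The layer condition is dropped: both events force the `2 * k - |overlap|` edges of the union
  -- below `T`. The overlap lemma then applies with `c = 1 / p`.
  have hAA : ∀ q ∈ Γ, ∀ q' ∈ Γ, P.real (A q ∩ A q') ≤
      p ^ (2 * k) * (1 / p) ^ (S q' ∩ S q).card := by
    intro q hq q' hq'
    have h1 : A q ∩ A q' ⊆ {ω | ∀ e ∈ S q ∪ S q', X e ω ≤ T} := by
      rintro ω ⟨h, h'⟩ e he
      exact (Finset.mem_union.1 he).elim (h.1 e) (h'.1 e)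
    refine (measureReal_mono h1).trans ?_
    rw [measureReal_forall_le hind hlaw (fun e he =>
      (Finset.mem_union.1 he).elim (hSA q e) (hSA q' e)) T, ← hpdef]
    have h2 := Finset.card_union_add_card_inter (S q) (S q')
    rw [hScard q hq, hScard q' hq', Finset.inter_comm] at h2
    rw [two_mul, ← h2, pow_add, mul_assoc, ← mul_pow, mul_one_div_cancel hp.ne', one_pow, mul_one]
  have hsub : (⋃ q ∈ Γ, A q) ⊆ {ω | ∃ p : SAPath n a b, weight (fun e => X e ω) p ≤ v} := by
    intro ω hω
    simp only [Set.mem_iUnion] at hω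
    obtain ⟨q, hq, hωB, hωD⟩ := hω
    have hqp : q.IsPath := (Finset.mem_filter.1 hq).2
    refine ⟨⟨q, hqp⟩, ?_⟩
    rw [weight_eq_sum]
    change ∑ e ∈ S q, X e ω ≤ v
    set N := ((S q).filter fun e => T' < X e ω).card with hN
    have h1 : ∏ e ∈ S q, h (X e ω) = 16 ^ N := by
      rw [hN, ← Finset.prod_const, Finset.prod_filter]
      refine Finset.prod_congr rfl fun e he => ?_
      have h2 : X e ω ≤ T := hωB e he
      by_cases h3 : T' < X e ω
      · simp only [hh, Set.indicator_of_mem (show X e ω ∈ Set.Iic T from h2),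
          Set.indicator_of_mem (show X e ω ∈ Set.Ioc T' T from ⟨h3, h2⟩), if_pos h3]
        norm_num
      · simp only [hh, Set.indicator_of_mem (show X e ω ∈ Set.Iic T from h2),
          Set.indicator_of_notMem (show X e ω ∉ Set.Ioc T' T from fun h => h3 h.1), if_neg h3]
        norm_num
    have h2 : 2 * N ≤ k := by
      by_contra hcon
      refine hωD ?_
      change 4 ^ k ≤ ∏ e ∈ S q, h (X e ω)
      rw [h1, show (16 : ℝ≥0∞) = 4 ^ 2 by norm_num, ← pow_mul]
      exact pow_le_pow_right₀ (by norm_num) (by omega)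
    have h3 : ∀ e ∈ S q, X e ω ≤ T' + if T' < X e ω then T - T' else 0 := by
      intro e he
      split_ifs with h4
      · linarith [hωB e he]
      · linarith
    refine (Finset.sum_le_sum h3).trans (le_trans (le_of_eq ?_) (le_trans (?_ :
      (k : ℝ) * T' + N * (T - T') ≤ k * T - k / 2 * (T - T')) hv))
    · rw [Finset.sum_add_distrib, Finset.sum_const, ← Finset.sum_filter, Finset.sum_const,
        hScard q hq, nsmul_eq_mul, nsmul_eq_mul]
    · have h5 : (2 : ℝ) * N ≤ k := by exact_mod_cast h2
      nlinarith
  have hmain := sq_sum_measureReal_le (P := P) Γ A hAm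
  set U := P.real {ω | ∃ p : SAPath n a b, weight (fun e => X e ω) p ≤ v} with hU
  set R := (1 / p) ^ k + (n + 2 * (1 / p)) ^ k / (n : ℝ) with hR
  have hR0 : 0 < R := by positivity
  have hhalf : (0 : ℝ) ≤ 1 - (1 / 2) ^ k := sub_nonneg.2 (pow_le_one₀ (by norm_num) (by norm_num))
  have hoverlap : ∀ q ∈ Γ, ∑ q' ∈ Γ, P.real (A q ∩ A q') ≤ p ^ (2 * k) * R := by
    intro q hq
    refine (Finset.sum_le_sum fun q' hq' => hAA q hq q' hq').trans ?_
    rw [← Finset.mul_sum]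
    refine mul_le_mul_of_nonneg_left ?_ (by positivity)
    have hq' := Finset.mem_filter.1 hq
    rw [mem_finsetWalkLength_iff] at hq'
    have h1 := sum_pow_card_edges_inter_le (G := completeGraphOn n) (S := Finset.Icc 1 n)
      (fun v w => mem_Icc_of_adj) (by simpa using hn) hq'.2 (c := 1 / p) (by positivity)
    rw [hq'.1, Nat.card_Icc, Nat.add_sub_cancel] at h1
    exact h1
  have hfin : (Γ.card * (p ^ k * (1 - (1 / 2) ^ k))) ^ 2 ≤
      U * (Γ.card * (p ^ (2 * k) * R)) := by
    calc _ ≤ (∑ q ∈ Γ, P.real (A q)) ^ 2 := by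
          refine pow_le_pow_left₀ (by positivity) ?_ 2
          rw [← nsmul_eq_mul]
          exact Finset.card_nsmul_le_sum _ _ _ hA
      _ ≤ P.real (⋃ q ∈ Γ, A q) * ∑ q ∈ Γ, ∑ q' ∈ Γ, P.real (A q ∩ A q') := hmain
      _ ≤ U * (Γ.card * (p ^ (2 * k) * R)) := by
          refine mul_le_mul (measureReal_mono hsub) ?_
            (Finset.sum_nonneg fun _ _ => Finset.sum_nonneg fun _ _ => measureReal_nonneg)
            measureReal_nonneg
          rw [← nsmul_eq_mul]
          exact Finset.sum_le_card_nsmul _ _ _ hoverlap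
  rcases Nat.eq_zero_or_pos Γ.card with h0 | h0
  · rw [h0, Nat.cast_zero, mul_zero]
    exact mul_nonneg measureReal_nonneg hR0.le
  · have hΓ0 : (0 : ℝ) < Γ.card := by exact_mod_cast h0
    have hpos : 0 < p ^ (2 * k) * (Γ.card : ℝ) := by positivity
    refine le_of_mul_le_mul_left ?_ hpos
    calc p ^ (2 * k) * (Γ.card : ℝ) * ((1 - (1 / 2) ^ k) ^ 2 * Γ.card)
        = (Γ.card * (p ^ k * (1 - (1 / 2) ^ k))) ^ 2 := by ring
      _ ≤ U * (Γ.card * (p ^ (2 * k) * R)) := hfin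
      _ = _ := by ring

end SecondMoment

end FPP

/-! ### The distribution near zero, the scale, and the second moment ratio. -/

namespace FPP

theorem exists_linear_bounds {G : ℝ → ℝ} (hG0 : G 0 = 0)
    (hG : 0 < derivWithin G (Set.Ici 0) 0) {η : ℝ} (hη : 0 < η) :
    ∃ δ > 0, ∀ z, 0 < z → z < δ → (1 - η) * derivWithin G (Set.Ici 0) 0 * z ≤ G z ∧
      G z ≤ (1 + η) * derivWithin G (Set.Ici 0) 0 * z := by
  set g := derivWithin G (Set.Ici 0) 0 with hg
  -- A nonzero `derivWithin` cannot be the default value, so `G` is differentiable at `0` from the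
  -- right.
  have hd : HasDerivWithinAt G g (Set.Ici 0) 0 :=
    (differentiableWithinAt_of_derivWithin_ne_zero hG.ne').hasDerivWithinAt
  have ht : Tendsto (slope G 0) (𝓝[>] 0) (𝓝 g) := by
    rw [hasDerivWithinAt_iff_tendsto_slope] at hd
    simpa using hd
  have h1 : ∀ᶠ z in 𝓝[>] (0 : ℝ), slope G 0 z ∈ Set.Icc ((1 - η) * g) ((1 + η) * g) :=
    ht.eventually (Icc_mem_nhds (by nlinarith) (by nlinarith))
  rw [eventually_nhdsWithin_iff, Metric.eventually_nhds_iff] at h1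
  obtain ⟨δ, hδ, h⟩ := h1
  refine ⟨δ, hδ, fun z hz hzδ => ?_⟩
  have h2 := h (y := z) (by rwa [Real.dist_eq, sub_zero, abs_of_pos hz]) hz
  rw [slope_def_field, hG0, sub_zero, sub_zero] at h2
  exact ⟨(le_div_iff₀ hz).1 h2.1, (div_le_iff₀ hz).1 h2.2⟩

theorem exists_quantile_bounds {G : ℝ → ℝ} (hG0 : G 0 = 0) (hmono : Monotone G) (hG1 : ∀ x, G x ≤ 1)
    (hcont : Continuous G) {xhat : ℝ} (hxhat : 0 < xhat) (hstrict : StrictMonoOn G (Set.Icc 0 xhat))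
    (hG : 0 < derivWithin G (Set.Ici 0) 0) :
    ∃ C, 1 ≤ C ∧ (∀ x, 0 < x → G x ≤ C * x) ∧
      ∀ᶠ n : ℕ in atTop, ∃ z, 0 < z ∧ z ≤ C / n ∧ G z = 1 / n ∧
        ∀ y, 0 < y → G y = 1 / n → y = z := by
  set g := derivWithin G (Set.Ici 0) 0 with hg
  obtain ⟨δ, hδ, hb⟩ := exists_linear_bounds hG0 hG (η := 1 / 2) (by norm_num)
  -- `2 * g` bounds `G` linearly below `δ`, `1 / δ` does so beyond `δ` through `G ≤ 1`, and `2 / g`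
  -- bounds the quantile.
  set C := max 1 (max (2 * g) (max (1 / δ) (2 / g))) with hC
  have hC1 : 1 ≤ C := le_max_left _ _
  have hC2 : 2 * g ≤ C := (le_max_left _ _).trans (le_max_right _ _)
  have hC3 : 1 / δ ≤ C := (le_max_left _ _).trans ((le_max_right _ _).trans (le_max_right _ _))
  have hC4 : 2 / g ≤ C := (le_max_right _ _).trans ((le_max_right _ _).trans (le_max_right _ _))
  refine ⟨C, hC1, fun x hx => ?_, ?_⟩
  · rcases lt_or_ge x δ with h | h
    · refine (hb x hx h).2.trans (mul_le_mul_of_nonneg_right ?_ hx.le)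
      linarith
    · calc G x ≤ 1 := hG1 x
        _ ≤ 1 / δ * x := by rw [one_div_mul_eq_div, le_div_iff₀ hδ]; linarith
        _ ≤ C * x := mul_le_mul_of_nonneg_right hC3 hx.le
  · set y₀ := min (δ / 2) xhat with hy₀
    have hy₀0 : 0 < y₀ := lt_min (by linarith) hxhat
    have hGy₀ : 0 < G y₀ := by
      rw [← hG0]
      exact hstrict ⟨le_rfl, hxhat.le⟩ ⟨hy₀0.le, min_le_right _ _⟩ hy₀0
    have hev : ∀ᶠ n : ℕ in atTop, (1 : ℝ) / n < G y₀ :=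
      tendsto_one_div_atTop_nhds_zero_nat.eventually (gt_mem_nhds hGy₀)
    filter_upwards [hev, eventually_gt_atTop 0] with n hn hn0
    have hn0' : (0 : ℝ) < n := by exact_mod_cast hn0
    have hninv : (0 : ℝ) < 1 / n := by positivity
    -- Monotonicity confines every solution to the interval where `G` is strictly increasing, which
    -- gives uniqueness.
    have key : ∀ y, 0 < y → G y = 1 / n → y < y₀ := by
      intro y _ hy
      by_contra hcon
      have := hmono (not_lt.1 hcon)
      linarith
    obtain ⟨z, hz, hGz⟩ := intermediate_value_Icc hy₀0.le hcont.continuousOn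
      (show 1 / (n : ℝ) ∈ Set.Icc (G 0) (G y₀) from ⟨by rw [hG0]; exact hninv.le, hn.le⟩)
    have hz0 : 0 < z := by
      refine lt_of_le_of_ne hz.1 fun h => ?_
      rw [← h, hG0] at hGz
      exact hninv.ne hGz
    refine ⟨z, hz0, ?_, hGz, fun y hy hGy => ?_⟩
    · have h1 := (hb z hz0 ((hz.2.trans (min_le_left _ _)).trans_lt (by linarith))).1
      rw [hGz] at h1
      calc z = 2 / g * ((1 - 1 / 2) * g * z) := by field_simp; norm_num
        _ ≤ 2 / g * (1 / n) := mul_le_mul_of_nonneg_left h1 (by positivity)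
        _ ≤ C * (1 / n) := mul_le_mul_of_nonneg_right hC4 hninv.le
        _ = C / n := by ring
    · exact hstrict.injOn ⟨hy.le, (key y hy hGy).le.trans (min_le_right _ _)⟩
        ⟨hz0.le, (key z hz0 hGz).le.trans (min_le_right _ _)⟩ (hGy.trans hGz.symm)

theorem measureReal_rpow_le {Ω₀ : Type*} [MeasurableSpace Ω₀] {μ : Measure Ω₀} {Z : Ω₀ → ℝ}
    (hZpos : ∀ᵐ ω ∂μ, 0 < Z ω) {s x : ℝ} (hs : 0 < s) (hx : 0 ≤ x) :
    μ.real {ω | Z ω ^ s ≤ x} = μ.real {ω | Z ω ≤ x ^ (1 / s)} := by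
  refine measureReal_congr (hZpos.mono fun ω hω => propext ?_)
  change Z ω ^ s ≤ x ↔ Z ω ≤ x ^ (1 / s)
  rw [one_div, Real.le_rpow_inv_iff_of_pos hω.le hx hs]

theorem scaleSet_eq_singleton {G F : ℝ → ℝ} {n : ℕ} {s z : ℝ} (hs : 0 < s) (hn : 0 < n)
    (hF : ∀ x, 0 < x → F x = G (x ^ (1 / s))) (hz : 0 < z) (hGz : G z = 1 / n)
    (huniq : ∀ y, 0 < y → G y = 1 / n → y = z) : scaleSet n F = {z ^ s} := by
  have hn' : (n : ℝ) ≠ 0 := by exact_mod_cast hn.ne'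
  ext x
  simp only [scaleSet, Set.mem_ofPred_eq, Set.mem_singleton_iff]
  constructor
  · rintro ⟨hx, h⟩
    rw [hF x hx] at h
    have := huniq (x ^ (1 / s)) (by positivity) (by field_simp; linarith)
    rw [← this, ← Real.rpow_mul hx.le, one_div_mul_cancel hs.ne', Real.rpow_one]
  · rintro rfl
    refine ⟨by positivity, ?_⟩
    rw [hF _ (by positivity), ← Real.rpow_mul hz.le, mul_one_div_cancel hs.ne', Real.rpow_one, hGz,
      mul_one_div_cancel hn']

/-- The probability bound of the second moment method, in terms of the length `k` and the
exponent `s`. -/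
theorem le_measureReal_of_second_moment {n k c : ℕ} {U p s : ℝ} (hk : 0 < k) (hkn : k ≤ n)
    (hn : 1 ≤ n)
    (hp : 0 < p) (hs : 0 < s) (hU : 0 ≤ U)
    (hd : 101 / 100 * Real.exp (1 / s) ≤ n * p) (hks : s * Real.log n ≤ k)
    (hc : (n - k) ^ (k - 1) ≤ c)
    (h : (1 - (1 / 2) ^ k) ^ 2 * (c : ℝ) ≤ U * ((1 / p) ^ k + (n + 2 * (1 / p)) ^ k / n)) :
    (1 - (1 / 2) ^ k) ^ 2 * (1 - (k : ℝ) ^ 2 / n) /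
      ((100 / 101) ^ k + Real.exp (2 * k * Real.exp (-(1 / s)))) ≤ U := by
  have hn0 : (0 : ℝ) < n := by exact_mod_cast hn
  have hden : 0 < ((100 / 101 : ℝ)) ^ k + Real.exp (2 * k * Real.exp (-(1 / s))) := by positivity
  rw [div_le_iff₀ hden]
  have hpow : (n : ℝ) ^ k = n * n ^ (k - 1) := by
    rw [← pow_succ']; congr 1; omega
  -- Bernoulli's inequality: self-avoidance costs a negligible share of the `n ^ (k - 1)` vertex
  -- sequences.
  have h1 : 1 - (k : ℝ) ^ 2 / n ≤ c / n ^ (k - 1) := by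
    have hc' : ((n : ℝ) - k) ^ (k - 1) ≤ c := by
      rw [← Nat.cast_sub hkn]; exact_mod_cast hc
    have h2 : 1 + ((k - 1 : ℕ) : ℝ) * (-(k / n)) ≤ (1 + -((k : ℝ) / n)) ^ (k - 1) := by
      refine one_add_mul_le_pow ?_ _
      have : (k : ℝ) / n ≤ 1 := (div_le_one hn0).2 (by exact_mod_cast hkn)
      linarith
    have h3 : (1 + -((k : ℝ) / n)) ^ (k - 1) = (n - k) ^ (k - 1) / n ^ (k - 1) := by
      rw [← div_pow]; congr 1; field_simp; ring
    have h4 : ((k - 1 : ℕ) : ℝ) ≤ k := by exact_mod_cast Nat.sub_le k 1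
    calc 1 - (k : ℝ) ^ 2 / n = 1 + k * (-(k / n)) := by ring
      _ ≤ 1 + ((k - 1 : ℕ) : ℝ) * (-(k / n)) := by
        have : 0 ≤ (k : ℝ) / n := by positivity
        nlinarith
      _ ≤ _ := h2
      _ = (n - k) ^ (k - 1) / n ^ (k - 1) := h3
      _ ≤ _ := by gcongr
  -- The diagonal term is `n / (n * p) ^ k`. Since `k ≥ s * log n`, `exp (1 / s) ^ k` already
  -- exceeds `n`, and the margin `101 / 100` gives geometric decay.
  have h5 : (1 / p) ^ k / n ^ (k - 1) ≤ (100 / 101) ^ k := by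
    have e1 : (1 / p) ^ k / (n : ℝ) ^ (k - 1) = n * (1 / (n * p)) ^ k := by
      rw [div_pow, div_pow, mul_pow, hpow, one_pow]; field_simp
    have e2 : (n : ℝ) ≤ Real.exp (1 / s) ^ k := by
      rw [← Real.exp_nat_mul, ← Real.log_le_iff_le_exp hn0, mul_one_div, le_div_iff₀ hs, mul_comm]
      exact hks
    calc (1 / p) ^ k / (n : ℝ) ^ (k - 1) = n * (1 / (n * p)) ^ k := e1
      _ ≤ Real.exp (1 / s) ^ k * (1 / (101 / 100 * Real.exp (1 / s))) ^ k := by gcongr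
      _ = (100 / 101) ^ k := by rw [← mul_pow]; congr 1; field_simp
  -- The off-diagonal term is `(1 + 2 / (n * p)) ^ k`, with `n * p ≥ exp (1 / s)`.
  have h6 : (n + 2 * (1 / p)) ^ k / n / n ^ (k - 1) ≤ Real.exp (2 * k * Real.exp (-(1 / s))) := by
    have e1 : (n + 2 * (1 / p)) ^ k / n / (n : ℝ) ^ (k - 1) = (2 / (n * p) + 1) ^ k := by
      rw [div_div, ← hpow, ← div_pow]; congr 1; field_simp; ring
    rw [e1, show 2 * (k : ℝ) * Real.exp (-(1 / s)) = k * (2 * Real.exp (-(1 / s))) by ring,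
      Real.exp_nat_mul]
    refine pow_le_pow_left₀ (by positivity) ((Real.add_one_le_exp _).trans (Real.exp_le_exp.2 ?_)) k
    rw [Real.exp_neg, div_eq_mul_inv]
    have : Real.exp (1 / s) ≤ n * p := by linarith [Real.exp_pos (1 / s)]
    gcongr
  calc (1 - (1 / 2) ^ k) ^ 2 * (1 - (k : ℝ) ^ 2 / n)
      ≤ (1 - (1 / 2) ^ k) ^ 2 * (c / n ^ (k - 1)) :=
        mul_le_mul_of_nonneg_left h1 (sq_nonneg _)
    _ = (1 - (1 / 2) ^ k) ^ 2 * c / n ^ (k - 1) := by ring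
    _ ≤ U * ((1 / p) ^ k + (n + 2 * (1 / p)) ^ k / n) / n ^ (k - 1) := by gcongr
    _ = U * ((1 / p) ^ k / n ^ (k - 1) + (n + 2 * (1 / p)) ^ k / n / n ^ (k - 1)) := by ring
    _ ≤ _ := mul_le_mul_of_nonneg_left (add_le_add h5 h6) hU

end FPP

/-! ### Asymptotics of the parameters. -/

namespace FPP

theorem tendsto_log_natCast : Tendsto (fun n : ℕ => Real.log n) atTop atTop :=
  Real.tendsto_log_atTop.comp tendsto_natCast_atTop_atTop

section Sequences

variable {s : ℕ → ℝ}

theorem tendsto_zero_of_sq_mul_log (hs0 : ∀ n, 0 < s n)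
    (hs₂ : Tendsto (fun n : ℕ => s n ^ 2 * Real.log n) atTop (𝓝 0)) : Tendsto s atTop (𝓝 0) := by
  have h1 : Tendsto (fun n : ℕ => √(s n ^ 2 * Real.log n)) atTop (𝓝 0) := by
    simpa using hs₂.sqrt
  refine squeeze_zero' (Eventually.of_forall fun n => (hs0 n).le) ?_ h1
  filter_upwards [tendsto_log_natCast.eventually_ge_atTop 1] with n hn
  refine Real.le_sqrt_of_sq_le ?_
  nlinarith [sq_nonneg (s n)]

/-- The product factors as `√(s n ^ 2 * log n)` times `log log n / √(log n)`, and both tend to zero.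
-/
theorem tendsto_mul_log_log (hs0 : ∀ n, 0 < s n)
    (hs₂ : Tendsto (fun n : ℕ => s n ^ 2 * Real.log n) atTop (𝓝 0)) :
    Tendsto (fun n : ℕ => s n * Real.log (Real.log n)) atTop (𝓝 0) := by
  have h1 : Tendsto (fun n : ℕ => √(s n ^ 2 * Real.log n)) atTop (𝓝 0) := by
    simpa using hs₂.sqrt
  have h2 : Tendsto (fun x : ℝ => Real.log x / √x) atTop (𝓝 0) := by
    have := (isLittleO_log_rpow_atTop (r := 1 / 2) (by norm_num)).tendsto_div_nhds_zero
    simpa only [← Real.sqrt_eq_rpow] using this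
  have h3 := h1.mul (h2.comp tendsto_log_natCast)
  rw [mul_zero] at h3
  refine h3.congr' ?_
  filter_upwards [tendsto_log_natCast.eventually_ge_atTop 1] with n hn
  have : 0 < √(Real.log n) := Real.sqrt_pos.2 (by linarith)
  simp only [Function.comp]
  rw [Real.sqrt_mul (sq_nonneg _), Real.sqrt_sq (hs0 n).le]
  field_simp

theorem tendsto_mul_log_const_mul_log (hs0 : ∀ n, 0 < s n)
    (hs₂ : Tendsto (fun n : ℕ => s n ^ 2 * Real.log n) atTop (𝓝 0)) {D : ℝ} (hD : 0 < D) :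
    Tendsto (fun n : ℕ => 2 * s n * Real.log (D * Real.log n)) atTop (𝓝 0) := by
  have h1 := ((tendsto_zero_of_sq_mul_log hs0 hs₂).mul_const (2 * Real.log D)).add
    ((tendsto_mul_log_log hs0 hs₂).const_mul 2)
  rw [zero_mul, mul_zero, add_zero] at h1
  refine h1.congr' ?_
  filter_upwards [tendsto_log_natCast.eventually_ge_atTop 1] with n hn
  rw [Real.log_mul hD.ne' (by linarith)]
  ring

theorem tendsto_sqrt_mul_log_log (hs0 : ∀ n, 0 < s n)
    (hs₂ : Tendsto (fun n : ℕ => s n ^ 2 * Real.log n) atTop (𝓝 0)) :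
    Tendsto (fun n : ℕ => √(s n * Real.log (Real.log n))) atTop (𝓝 0) := by
  simpa using (tendsto_mul_log_log hs0 hs₂).sqrt

theorem tendsto_floor_div (hs₁ : Tendsto (fun n : ℕ => s n * Real.log n) atTop atTop) :
    Tendsto (fun n : ℕ => (⌊s n * Real.log n⌋₊ : ℝ) / (s n * Real.log n)) atTop (𝓝 1) :=
  (tendsto_nat_floor_div_atTop (R := ℝ)).comp hs₁

theorem tendsto_ceil_div (hs₁ : Tendsto (fun n : ℕ => s n * Real.log n) atTop atTop) :
    Tendsto (fun n : ℕ => (⌈s n * Real.log n⌉₊ : ℝ) / (s n * Real.log n)) atTop (𝓝 1) :=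
  (tendsto_nat_ceil_div_atTop (R := ℝ)).comp hs₁

theorem tendsto_sqrt_mul_log_atTop
    (hs₁ : Tendsto (fun n : ℕ => s n * Real.log n) atTop atTop) :
    Tendsto (fun n : ℕ => √(s n * Real.log (Real.log n)) * Real.log n) atTop atTop := by
  refine tendsto_atTop_mono' _ ?_ (Real.tendsto_sqrt_atTop.comp hs₁)
  filter_upwards [tendsto_log_natCast.eventually_ge_atTop (Real.exp 1),
    hs₁.eventually_ge_atTop 0] with n hn hn0
  have he : 1 ≤ Real.exp 1 := Real.one_le_exp zero_le_one
  have hL : 1 ≤ Real.log n := he.trans hn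
  have hLL : 1 ≤ Real.log (Real.log n) := by
    rwa [Real.le_log_iff_exp_le (by linarith)]
  have hs : 0 ≤ s n := nonneg_of_mul_nonneg_left hn0 (by linarith)
  simp only [Function.comp]
  rw [Real.sqrt_le_iff]
  refine ⟨by positivity, ?_⟩
  rw [mul_pow, Real.sq_sqrt (mul_nonneg hs (by linarith))]
  have h1 : s n * Real.log n * 1 ≤ s n * Real.log n * (Real.log (Real.log n) * Real.log n) :=
    mul_le_mul_of_nonneg_left (one_le_mul_of_one_le_of_one_le hLL hL) hn0
  nlinarith

/-- Eventually `ν ≤ 4 * ε ^ 2`, so `(1 - ε) * exp ν ≤ 1 - ε / 2` and the exponent is at most `-(ε *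
log n) / 2`. This is where the size of `ε` is dictated. -/
theorem tendsto_lower_exponent (hs0 : ∀ n, 0 < s n)
    (hs₁ : Tendsto (fun n : ℕ => s n * Real.log n) atTop atTop)
    (hs₂ : Tendsto (fun n : ℕ => s n ^ 2 * Real.log n) atTop (𝓝 0)) {D : ℝ} (hD : 0 < D) :
    Tendsto (fun n : ℕ => -Real.log n + (1 - √(s n * Real.log (Real.log n))) *
      ⌊s n * Real.log n⌋₊ * Real.exp (2 * s n * Real.log (D * Real.log n)) / s n) atTop atBot := by
  have hlim : Tendsto (fun n : ℕ => -(√(s n * Real.log (Real.log n)) * Real.log n / 2))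
      atTop atBot :=
    tendsto_neg_atTop_atBot.comp ((tendsto_sqrt_mul_log_atTop hs₁).atTop_div_const two_pos)
  refine tendsto_atBot_mono' _ ?_ hlim
  have hε := tendsto_sqrt_mul_log_log hs0 hs₂
  have hν := tendsto_mul_log_const_mul_log hs0 hs₂ hD
  filter_upwards [hε.eventually_le_const (show (0 : ℝ) < 1 / 16 by norm_num),
    hν.eventually_le_const (show (0 : ℝ) < 1 by norm_num),
    tendsto_log_natCast.eventually_ge_atTop (Real.exp 1),
    (Real.tendsto_log_atTop.comp tendsto_log_natCast).eventually_ge_atTop (Real.log D),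
    tendsto_log_natCast.eventually_ge_atTop (1 / D)] with n h1 h2 h3 h4 h5
  set L := Real.log n
  set ε := √(s n * Real.log L) with hεdef
  set ν := 2 * s n * Real.log (D * L) with hνdef
  have hs := hs0 n
  have hL : 1 ≤ L := (Real.one_le_exp zero_le_one).trans h3
  have hLL : 1 ≤ Real.log L := by rwa [Real.le_log_iff_exp_le (by linarith)]
  have hε0 : 0 ≤ ε := Real.sqrt_nonneg _
  have hε2 : ε ^ 2 = s n * Real.log L := Real.sq_sqrt (by positivity)
  have hν0 : 0 ≤ ν := by
    have : 1 ≤ D * L := by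
      have := mul_le_mul_of_nonneg_left h5 hD.le
      rwa [mul_one_div_cancel hD.ne'] at this
    have := Real.log_nonneg this
    positivity
  have hνε : ν ≤ 4 * ε ^ 2 := by
    rw [hε2, hνdef, Real.log_mul hD.ne' (by linarith)]
    simp only [Function.comp] at h4
    nlinarith
  have hexp : Real.exp ν ≤ 1 + 2 * ν := by
    have := Real.abs_exp_sub_one_sub_id_le (x := ν) (by rwa [abs_of_nonneg hν0])
    have := (abs_le.1 this).2
    nlinarith
  have hprod : (1 - ε) * Real.exp ν ≤ 1 - ε / 2 := by
    calc (1 - ε) * Real.exp ν ≤ (1 - ε) * (1 + 2 * ν) :=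
          mul_le_mul_of_nonneg_left hexp (by linarith)
      _ ≤ 1 - ε + 2 * ν := by nlinarith
      _ ≤ 1 - ε / 2 := by nlinarith
  have hfl : (⌊s n * L⌋₊ : ℝ) ≤ s n * L := Nat.floor_le (by positivity)
  have : (1 - ε) * ⌊s n * L⌋₊ * Real.exp ν / s n ≤ (1 - ε / 2) * L := by
    rw [div_le_iff₀ hs]
    have h7 : 0 ≤ (1 - ε) * Real.exp ν := mul_nonneg (by linarith) (Real.exp_nonneg _)
    calc (1 - ε) * ⌊s n * L⌋₊ * Real.exp ν = (1 - ε) * Real.exp ν * ⌊s n * L⌋₊ := by ring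
      _ ≤ (1 - ε) * Real.exp ν * (s n * L) := mul_le_mul_of_nonneg_left hfl h7
      _ ≤ (1 - ε / 2) * (s n * L) := mul_le_mul_of_nonneg_right hprod (by positivity)
      _ = _ := by ring
  linarith

/-- The left side is largest at `k = y / exp 1`, the source of the constant `e`; the proof is `log t
≤ t - 1` at `t = y / (k * exp 1)`. -/
theorem mul_log_div_le {k y : ℝ} (hk : 0 < k) (hy : 0 < y) :
    k * Real.log (y / k) ≤ y / Real.exp 1 := by
  have h1 := Real.log_le_sub_one_of_pos (show 0 < y / k / Real.exp 1 by positivity)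
  rw [Real.log_div (by positivity) (by positivity), Real.log_exp] at h1
  calc k * Real.log (y / k) ≤ k * (y / k / Real.exp 1) :=
        mul_le_mul_of_nonneg_left (by linarith) hk.le
    _ = y / Real.exp 1 := by field_simp

/-- Taking `log t ≤ t - 1` at `t = 1 / √y` bounds the left side by `1 - (√y - 1) ^ 2`, an explicit
gap below the maximum at `y = 1`. -/
theorem mul_one_sub_log_le {y δ : ℝ} (hy : 0 < y) (hδ0 : 0 < δ) (hδ : δ ≤ 1) (h : δ ≤ |y - 1|) :
    y * (1 - Real.log y) ≤ 1 - (δ / 3) ^ 2 := by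
  have hq : 0 < √y := Real.sqrt_pos.2 hy
  have hqq : √y * √y = y := Real.mul_self_sqrt hy.le
  have h1 := Real.log_le_sub_one_of_pos (inv_pos.2 hq)
  rw [Real.log_inv, Real.log_sqrt hy.le] at h1
  have h2 : y * (√y)⁻¹ = √y := by nth_rewrite 1 [← hqq]; field_simp
  have h3 : y * (1 - Real.log y) ≤ 1 - (√y - 1) ^ 2 := by
    have : y * (-(Real.log y / 2)) ≤ √y - y := by
      calc _ ≤ y * ((√y)⁻¹ - 1) := mul_le_mul_of_nonneg_left h1 hy.le
        _ = _ := by rw [mul_sub, h2, mul_one]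
    nlinarith
  have h4 : δ / 3 ≤ |√y - 1| := by
    by_contra hcon
    rw [not_le, abs_lt] at hcon
    rcases le_abs.1 h with h5 | h5 <;> nlinarith
  have h5 : (δ / 3) ^ 2 ≤ (√y - 1) ^ 2 := by
    rw [← sq_abs (√y - 1)]
    exact pow_le_pow_left₀ (by positivity) h4 2
  linarith

end Sequences

/-! ### First moment limits: light paths and atypical lengths. -/

section FirstMoment

variable {Ω₀ : Type*} [MeasurableSpace Ω₀] {μ : Measure Ω₀} [IsProbabilityMeasure μ]
  {Z : Ω₀ → ℝ} {C : ℝ} {s u : ℕ → ℝ} {Ω : ℕ → Type*} [∀ n, MeasurableSpace (Ω n)]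
  {P : ∀ n, Measure (Ω n)} {X : ∀ n, Sym2 ℕ → Ω n → ℝ} {a b : ℕ → ℕ}

theorem tendsto_measure_exists_path (hZ : Measurable Z) (hZpos : ∀ᵐ ω ∂μ, 0 < Z ω)
    (hC1 : 1 ≤ C) (hC : ∀ x, 0 < x → μ.real {ω | Z ω ≤ x} ≤ C * x) (hs0 : ∀ n, 0 < s n)
    (hind : ∀ n, iIndepFun (fun e : (completeGraphOn n).edgeSet => X n e) (P n))
    (hlaw : ∀ n, ∀ e ∈ (completeGraphOn n).edgeSet,
      IdentDistrib (X n e) (fun ω => Z ω ^ s n) (P n) μ)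
    (hab : ∀ᶠ n in atTop, a n ≠ b n)
    (hu : ∀ᶠ n in atTop, 0 < u n ∧ u n ^ (1 / s n) ≤ C / n)
    {w M : ℕ → ℝ} {A : ℕ → Set ℕ} (hw : ∀ᶠ n in atTop, 0 < w n) (hM0 : ∀ᶠ n in atTop, 0 ≤ M n)
    (hM : ∀ᶠ n : ℕ in atTop, ∀ k ∈ A n, 0 < k → (k : ℝ) * Real.log (w n * Real.exp
      (2 * s n * Real.log (4 * Real.exp 1 * C ^ 2 * Real.log n)) / k) ≤ M n)
    (hlim : Tendsto (fun n : ℕ => -Real.log n + M n / s n) atTop atBot) :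
    Tendsto (fun n => P n {ω | ∃ p : SAPath n (a n) (b n),
      p.1.length ∈ A n ∧ weight (fun e => X n e ω) p ≤ w n * u n}) atTop (𝓝 0) := by
  have h1 : Tendsto (fun n : ℕ => ENNReal.ofReal (Real.exp (-Real.log n + M n / s n))) atTop
      (𝓝 0) := by
    rw [← ENNReal.ofReal_zero]
    exact ENNReal.tendsto_ofReal (Real.tendsto_exp_atBot.comp hlim)
  refine tendsto_of_tendsto_of_tendsto_of_le_of_le' tendsto_const_nhds h1
    (Eventually.of_forall fun n => zero_le) ?_
  filter_upwards [hab, hu, hw, hM0, hM, tendsto_log_natCast.eventually_ge_atTop 2]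
    with n hab hu hw hM0 hM hn
  exact measure_exists_path_le_exp hab (hind n) (hlaw n) hZ hZpos hC1 hC (hs0 n) hn hu.1 hu.2 hw
    hM0 (A n) hM

theorem tendsto_measure_light_path (hZ : Measurable Z) (hZpos : ∀ᵐ ω ∂μ, 0 < Z ω)
    (hC1 : 1 ≤ C) (hC : ∀ x, 0 < x → μ.real {ω | Z ω ≤ x} ≤ C * x) (hs0 : ∀ n, 0 < s n)
    (hs₁ : Tendsto (fun n : ℕ => s n * Real.log n) atTop atTop)
    (hs₂ : Tendsto (fun n : ℕ => s n ^ 2 * Real.log n) atTop (𝓝 0))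
    (hind : ∀ n, iIndepFun (fun e : (completeGraphOn n).edgeSet => X n e) (P n))
    (hlaw : ∀ n, ∀ e ∈ (completeGraphOn n).edgeSet,
      IdentDistrib (X n e) (fun ω => Z ω ^ s n) (P n) μ)
    (hab : ∀ᶠ n in atTop, a n ≠ b n)
    (hu : ∀ᶠ n in atTop, 0 < u n ∧ u n ^ (1 / s n) ≤ C / n) :
    Tendsto (fun n => P n {ω | ∃ p : SAPath n (a n) (b n), weight (fun e => X n e ω) p ≤
      (1 - √(s n * Real.log (Real.log n))) * Real.exp 1 * ⌊s n * Real.log n⌋₊ * u n})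
      atTop (𝓝 0) := by
  have hD : 0 < 4 * Real.exp 1 * C ^ 2 := by positivity
  have hw : ∀ᶠ n : ℕ in atTop, 0 < 1 - √(s n * Real.log (Real.log n)) ∧
      0 < (⌊s n * Real.log n⌋₊ : ℝ) := by
    filter_upwards [(tendsto_sqrt_mul_log_log hs0 hs₂).eventually_lt_const one_pos,
      hs₁.eventually_ge_atTop 1] with n h1 h2
    exact ⟨by linarith, by exact_mod_cast Nat.floor_pos.2 h2⟩
  have h := tendsto_measure_exists_path (w := fun n => (1 - √(s n * Real.log (Real.log n))) *
      Real.exp 1 * ⌊s n * Real.log n⌋₊) (A := fun _ => Set.univ) hZ hZpos hC1 hC hs0 hind hlaw hab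
      hu (hw.mono fun n h => by have := h.1; have := h.2; positivity)
      (hw.mono fun n h => by
        have := h.1; have := h.2
        show 0 ≤ (1 - √(s n * Real.log (Real.log n))) * ⌊s n * Real.log n⌋₊ *
          Real.exp (2 * s n * Real.log (4 * Real.exp 1 * C ^ 2 * Real.log n))
        positivity) (hw.mono fun n h k _ hk => ?_)
      (tendsto_lower_exponent hs0 hs₁ hs₂ hD)
  · simpa only [Set.mem_univ, true_and] using h
  · have := h.1
    have := h.2
    refine (mul_log_div_le (by exact_mod_cast hk) (by positivity)).trans (le_of_eq ?_)
    field_simp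

/-- At the critical weight the best length has exponent zero to leading order. Other lengths lose a
fixed fraction of `log n`, which dominates rounding and the inflation by `exp ν`. -/
theorem tendsto_measure_atypical_length (hZ : Measurable Z) (hZpos : ∀ᵐ ω ∂μ, 0 < Z ω)
    (hC1 : 1 ≤ C) (hC : ∀ x, 0 < x → μ.real {ω | Z ω ≤ x} ≤ C * x) (hs0 : ∀ n, 0 < s n)
    (hs₁ : Tendsto (fun n : ℕ => s n * Real.log n) atTop atTop)
    (hs₂ : Tendsto (fun n : ℕ => s n ^ 2 * Real.log n) atTop (𝓝 0))
    (hind : ∀ n, iIndepFun (fun e : (completeGraphOn n).edgeSet => X n e) (P n))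
    (hlaw : ∀ n, ∀ e ∈ (completeGraphOn n).edgeSet,
      IdentDistrib (X n e) (fun ω => Z ω ^ s n) (P n) μ)
    (hab : ∀ᶠ n in atTop, a n ≠ b n)
    (hu : ∀ᶠ n in atTop, 0 < u n ∧ u n ^ (1 / s n) ≤ C / n) {δ : ℝ} (hδ0 : 0 < δ) (hδ1 : δ ≤ 1) :
    Tendsto (fun n => P n {ω | ∃ p : SAPath n (a n) (b n),
      p.1.length ∈ {k : ℕ | δ ≤ |(k : ℝ) / (s n * Real.log n) - 1|} ∧
      weight (fun e => X n e ω) p ≤ Real.exp 1 * ⌈s n * Real.log n⌉₊ * u n}) atTop (𝓝 0) := by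
  have hD : 0 < 4 * Real.exp 1 * C ^ 2 := by positivity
  -- Only `δ / 2` of the deviation is used: passing from `k / K n` to `y` divides by `ρ n`, which
  -- may consume the rest.
  set c := (δ / 2 / 3) ^ 2 with hc
  have hc0 : 0 < c := by positivity
  have hc1 : c ≤ 1 := pow_le_one₀ (by positivity) (by linarith)
  set K : ℕ → ℝ := fun n => s n * Real.log n with hK
  set ν : ℕ → ℝ := fun n => 2 * s n * Real.log (4 * Real.exp 1 * C ^ 2 * Real.log n) with hν
  -- Rounding and inflation combined; the optimal length becomes `K n * ρ n`.
  set ρ : ℕ → ℝ := fun n => ⌈K n⌉₊ / K n * Real.exp (ν n) with hρdef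
  have hρ : Tendsto ρ atTop (𝓝 1) := by
    have h1 : Tendsto (fun n => Real.exp (ν n)) atTop (𝓝 1) := by
      rw [← Real.exp_zero]
      exact (Real.continuous_exp.tendsto 0).comp (tendsto_mul_log_const_mul_log hs0 hs₂ hD)
    simpa using (tendsto_ceil_div hs₁).mul h1
  have hKpos : ∀ᶠ n in atTop, 0 < K n := hs₁.eventually_gt_atTop 0
  have hρpos : ∀ᶠ n in atTop, 0 < ρ n := hρ.eventually_const_lt one_pos
  refine tendsto_measure_exists_path (w := fun n => Real.exp 1 * ⌈K n⌉₊)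
    (M := fun n => K n * (ρ n * (1 - c))) hZ hZpos hC1 hC hs0 hind hlaw hab
    hu ?_ ?_ ?_ ?_
  · filter_upwards [hKpos] with n hn
    have : (0 : ℝ) < ⌈K n⌉₊ := by exact_mod_cast Nat.ceil_pos.2 hn
    positivity
  · filter_upwards [hKpos, hρpos] with n h1 h2
    have : 0 ≤ 1 - c := by linarith
    positivity
  · have hρ1 : ∀ᶠ n in atTop, ρ n < 1 + δ / 4 := hρ.eventually_lt_const (by linarith)
    have hρ2 : ∀ᶠ n in atTop, 1 - δ / 4 < ρ n := hρ.eventually_const_lt (by linarith)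
    filter_upwards [hKpos, hρpos, hρ1, hρ2] with n h1 h2 h3 h4 k hk hk0
    have hk0' : (0 : ℝ) < k := by exact_mod_cast hk0
    set y := (k : ℝ) / K n / ρ n with hy
    have hy0 : 0 < y := by positivity
    have hyk : (k : ℝ) = K n * ρ n * y := by rw [hy]; field_simp
    have hdev : δ / 2 ≤ |y - 1| := by
      have hk' : δ ≤ |(k : ℝ) / K n - 1| := hk
      have e1 : (k : ℝ) / K n = ρ n * y := by rw [hy]; field_simp
      rw [e1] at hk'
      rcases le_abs.1 hk' with h5 | h5
      · refine le_abs.2 (Or.inl ?_)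
        by_contra hcon
        have : y < 1 + δ / 2 := by linarith
        have := mul_lt_mul'' h3 this h2.le hy0.le
        nlinarith
      · refine le_abs.2 (Or.inr ?_)
        by_contra hcon
        have h6 : 1 - δ / 2 < y := by linarith
        have := mul_lt_mul'' h4 h6 (by linarith) (by linarith)
        nlinarith
    have hmain := mul_one_sub_log_le hy0 (by linarith) (by linarith) hdev
    have hlog : Real.log (Real.exp 1 * ⌈K n⌉₊ * Real.exp (ν n) / k) = 1 - Real.log y := by
      have : Real.exp 1 * ⌈K n⌉₊ * Real.exp (ν n) / k = Real.exp 1 / y := by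
        rw [hy, hρdef]; field_simp
      rw [this, Real.log_div (by positivity) hy0.ne', Real.log_exp]
    calc (k : ℝ) * Real.log (Real.exp 1 * ⌈K n⌉₊ * Real.exp (ν n) / k)
        = K n * (ρ n * (y * (1 - Real.log y))) := by rw [hlog, hyk]; ring
      _ ≤ K n * (ρ n * (1 - c)) := by gcongr
  · have h1 : ∀ᶠ n in atTop, ρ n < 1 + c / 2 := hρ.eventually_lt_const (by linarith)
    have h2 : Tendsto (fun n : ℕ => -(Real.log n * (c / 2))) atTop atBot :=
      tendsto_neg_atTop_atBot.comp (tendsto_log_natCast.atTop_mul_const (by positivity))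
    refine tendsto_atBot_mono' _ ?_ h2
    filter_upwards [h1, hρpos, tendsto_log_natCast.eventually_ge_atTop 0] with n h3 h4 h5
    have e1 : K n * (ρ n * (1 - c)) / s n = Real.log n * (ρ n * (1 - c)) := by
      have := (hs0 n).ne'
      simp only [hK]; field_simp
    have e2 : ρ n * (1 - c) ≤ 1 - c / 2 := by nlinarith
    rw [e1]
    nlinarith [mul_le_mul_of_nonneg_left e2 h5]

end FirstMoment

end FPP

/-! ### Second moment limit. -/

namespace FPP

section SecondMomentLimit

variable {s : ℕ → ℝ}

theorem tendsto_ceil_atTop (hs₁ : Tendsto (fun n : ℕ => s n * Real.log n) atTop atTop) :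
    Tendsto (fun n : ℕ => ⌈s n * Real.log n⌉₊) atTop atTop :=
  tendsto_nat_ceil_atTop.comp hs₁

theorem ceil_le_two_mul {x : ℝ} (hx : 1 ≤ x) : (⌈x⌉₊ : ℝ) ≤ 2 * x := by
  linarith [Nat.ceil_lt_add_one (zero_le_one.trans hx)]

theorem tendsto_ceil_sq_div (hs0 : ∀ n, 0 < s n)
    (hs₁ : Tendsto (fun n : ℕ => s n * Real.log n) atTop atTop)
    (hs₂ : Tendsto (fun n : ℕ => s n ^ 2 * Real.log n) atTop (𝓝 0)) :
    Tendsto (fun n : ℕ => (⌈s n * Real.log n⌉₊ : ℝ) ^ 2 / n) atTop (𝓝 0) := by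
  have h1 : Tendsto (fun n : ℕ => 4 * (Real.log n ^ 2 * Real.exp (-Real.log n))) atTop (𝓝 0) := by
    simpa using ((Real.tendsto_pow_mul_exp_neg_atTop_nhds_zero 2).comp
      tendsto_log_natCast).const_mul 4
  refine squeeze_zero' (Eventually.of_forall fun n => by positivity) ?_ h1
  filter_upwards [hs₁.eventually_ge_atTop 1, eventually_gt_atTop 0,
    (tendsto_zero_of_sq_mul_log hs0 hs₂).eventually_le_const one_pos,
    tendsto_log_natCast.eventually_ge_atTop 0] with n hn hn0 hsn hL
  have hn0' : (0 : ℝ) < n := by exact_mod_cast hn0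
  rw [Real.exp_neg, Real.exp_log hn0', ← div_eq_mul_inv, ← mul_div_assoc]
  gcongr
  calc (⌈s n * Real.log n⌉₊ : ℝ) ^ 2 ≤ (2 * Real.log n) ^ 2 := by
        refine pow_le_pow_left₀ (by positivity) ((ceil_le_two_mul hn).trans ?_) 2
        nlinarith
    _ = 4 * Real.log n ^ 2 := by ring

/-- Once `s n ^ 2 * log n ≤ 1`, the length is at most `2 / s n`, which `exp (-(1 / s n))` dominates.
-/
theorem tendsto_ceil_mul_exp_neg (hs0 : ∀ n, 0 < s n)
    (hs₁ : Tendsto (fun n : ℕ => s n * Real.log n) atTop atTop)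
    (hs₂ : Tendsto (fun n : ℕ => s n ^ 2 * Real.log n) atTop (𝓝 0)) :
    Tendsto (fun n : ℕ => 2 * (⌈s n * Real.log n⌉₊ : ℝ) * Real.exp (-(1 / s n))) atTop (𝓝 0) := by
  have hinv : Tendsto (fun n : ℕ => 1 / s n) atTop atTop := by
    simp only [one_div]
    exact Tendsto.inv_tendsto_nhdsGT_zero (tendsto_nhdsWithin_iff.2
      ⟨tendsto_zero_of_sq_mul_log hs0 hs₂, Eventually.of_forall hs0⟩)
  have h1 : Tendsto (fun n : ℕ => 4 * ((1 / s n) ^ 1 * Real.exp (-(1 / s n)))) atTop (𝓝 0) := by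
    simpa using ((Real.tendsto_pow_mul_exp_neg_atTop_nhds_zero 1).comp hinv).const_mul 4
  refine squeeze_zero' (Eventually.of_forall fun n => by positivity) ?_ h1
  filter_upwards [hs₁.eventually_ge_atTop 1, hs₂.eventually_le_const one_pos] with n hn hn2
  have hs := hs0 n
  have h2 : s n * Real.log n ≤ 1 / s n := by
    rw [le_div_iff₀ hs]; nlinarith
  have h3 := ceil_le_two_mul hn
  rw [pow_one, ← mul_assoc]
  refine mul_le_mul_of_nonneg_right ?_ (Real.exp_nonneg _)
  linarith

theorem tendsto_second_moment_ratio (hs0 : ∀ n, 0 < s n)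
    (hs₁ : Tendsto (fun n : ℕ => s n * Real.log n) atTop atTop)
    (hs₂ : Tendsto (fun n : ℕ => s n ^ 2 * Real.log n) atTop (𝓝 0)) :
    Tendsto (fun n : ℕ => (1 - (1 / 2 : ℝ) ^ ⌈s n * Real.log n⌉₊) ^ 2 *
      (1 - (⌈s n * Real.log n⌉₊ : ℝ) ^ 2 / n) / ((100 / 101) ^ ⌈s n * Real.log n⌉₊ +
        Real.exp (2 * ⌈s n * Real.log n⌉₊ * Real.exp (-(1 / s n))))) atTop (𝓝 1) := by
  have hk := tendsto_ceil_atTop hs₁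
  have h1 : Tendsto (fun n : ℕ => (1 / 2 : ℝ) ^ ⌈s n * Real.log n⌉₊) atTop (𝓝 0) :=
    (tendsto_pow_atTop_nhds_zero_of_lt_one (by norm_num) (by norm_num)).comp hk
  have h2 : Tendsto (fun n : ℕ => (100 / 101 : ℝ) ^ ⌈s n * Real.log n⌉₊) atTop (𝓝 0) :=
    (tendsto_pow_atTop_nhds_zero_of_lt_one (by norm_num) (by norm_num)).comp hk
  have h3 := (Real.continuous_exp.tendsto 0).comp (tendsto_ceil_mul_exp_neg hs0 hs₁ hs₂)
  rw [Real.exp_zero] at h3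
  have h4 := (((tendsto_const_nhds (x := (1 : ℝ))).sub h1).pow 2).mul
    ((tendsto_const_nhds (x := (1 : ℝ))).sub (tendsto_ceil_sq_div hs0 hs₁ hs₂))
  have h5 := h4.div (h2.add h3) (by norm_num)
  simpa [Pi.div_def] using h5

/-- Keeps the threshold, seen on the scale of `Z`, near zero where `G` is almost linear: once `s n *
log n ≥ 2`, `exp (1 / s n)` is at most `√n`. -/
theorem tendsto_exp_inv_mul_div (hs0 : ∀ n, 0 < s n)
    (hs₁ : Tendsto (fun n : ℕ => s n * Real.log n) atTop atTop) (C : ℝ) :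
    Tendsto (fun n : ℕ => Real.exp (1 / s n + 1) * (C / n)) atTop (𝓝 0) := by
  have h1 : Tendsto (fun n : ℕ => |C| * Real.exp 1 * Real.exp (-(Real.log n / 2))) atTop (𝓝 0) := by
    simpa using (Real.tendsto_exp_atBot.comp (tendsto_neg_atTop_atBot.comp
      (tendsto_log_natCast.atTop_div_const two_pos))).const_mul (|C| * Real.exp 1)
  refine squeeze_zero_norm' ?_ h1
  filter_upwards [hs₁.eventually_ge_atTop 2, eventually_gt_atTop 0] with n hn hn0
  have hn0' : (0 : ℝ) < n := by exact_mod_cast hn0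
  have hs := hs0 n
  rw [Real.norm_eq_abs, abs_mul, abs_div, abs_of_pos (Real.exp_pos _), abs_of_pos hn0']
  have h2 : 1 / s n ≤ Real.log n / 2 := by
    rw [div_le_div_iff₀ hs two_pos]; linarith
  calc Real.exp (1 / s n + 1) * (|C| / n)
      = |C| * Real.exp 1 * Real.exp (1 / s n - Real.log n) := by
        rw [Real.exp_sub, Real.exp_log hn0', Real.exp_add]; ring
    _ ≤ |C| * Real.exp 1 * Real.exp (-(Real.log n / 2)) := by
        gcongr; linarith

/-- A relative change of order `s` in an edge weight is a constant factor on the scale of `Z`; the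
lower bound is Bernoulli's inequality. -/
theorem one_add_div_rpow_inv_bounds {s : ℝ} (hs : 0 < s) (hs1 : s ≤ 1) :
    65 / 64 ≤ (1 + s / 64) ^ (1 / s) ∧ (1 + s / 64) ^ (1 / s) ≤ Real.exp 1 := by
  have h1 : 1 ≤ 1 / s := one_le_one_div hs hs1
  constructor
  · have := one_add_mul_self_le_rpow_one_add (s := s / 64) (by linarith) h1
    have h2 : 1 + 1 / s * (s / 64) = 65 / 64 := by field_simp; norm_num
    linarith
  · calc (1 + s / 64) ^ (1 / s) ≤ Real.exp (s / 64) ^ (1 / s) :=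
          Real.rpow_le_rpow (by positivity) (by linarith [Real.add_one_le_exp (s / 64)])
            (by positivity)
      _ = Real.exp (1 / 64) := by
          rw [← Real.exp_mul]; congr 1; field_simp
      _ ≤ Real.exp 1 := Real.exp_le_exp.2 (by norm_num)

theorem le_one_sub_div_rpow_inv {s : ℝ} (hs : 0 < s) (hs1 : s ≤ 1) :
    31 / 32 ≤ (1 - s / 32) ^ (1 / s) := by
  have h1 : 1 ≤ 1 / s := one_le_one_div hs hs1
  have := one_add_mul_self_le_rpow_one_add (s := -(s / 32)) (by linarith) h1
  have h2 : 1 + 1 / s * (-(s / 32)) = 31 / 32 := by field_simp; norm_num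
  rw [← sub_eq_add_neg 1 (s / 32)] at this
  linarith

theorem measureReal_Ioc_add {Ω₀ : Type*} [MeasurableSpace Ω₀] {μ : Measure Ω₀} [IsFiniteMeasure μ]
    {Y : Ω₀ → ℝ} (hY : Measurable Y) {x y : ℝ} (hxy : x ≤ y) :
    μ.real {ω | x < Y ω ∧ Y ω ≤ y} + μ.real {ω | Y ω ≤ x} = μ.real {ω | Y ω ≤ y} := by
  have hsub : {ω | Y ω ≤ x} ⊆ {ω | Y ω ≤ y} := fun ω (h : Y ω ≤ x) => h.trans hxy
  rw [← measureReal_sdiff_add_inter (s := {ω | Y ω ≤ y}) (measurableSet_le hY measurable_const),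
    Set.inter_eq_self_of_subset_right hsub]
  congr 2
  ext ω
  simp [and_comm]

theorem tendsto_measureReal_exists_path_le_ceil {Ω₀ : Type*} [MeasurableSpace Ω₀]
    {μ : Measure Ω₀} [IsProbabilityMeasure μ] {Z : Ω₀ → ℝ} {C : ℝ} {u : ℕ → ℝ} {Ω : ℕ → Type*}
    [∀ n, MeasurableSpace (Ω n)] {P : ∀ n, Measure (Ω n)} [∀ n, IsProbabilityMeasure (P n)]
    {X : ∀ n, Sym2 ℕ → Ω n → ℝ} {a b : ℕ → ℕ} {G : ℝ → ℝ}
    (hZ : Measurable Z) (hZpos : ∀ᵐ ω ∂μ, 0 < Z ω) (hG : ∀ x, G x = μ.real {ω | Z ω ≤ x})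
    (hG0 : G 0 = 0) (hGd : 0 < derivWithin G (Set.Ici 0) 0) (hs0 : ∀ n, 0 < s n)
    (hs₁ : Tendsto (fun n : ℕ => s n * Real.log n) atTop atTop)
    (hs₂ : Tendsto (fun n : ℕ => s n ^ 2 * Real.log n) atTop (𝓝 0))
    (hind : ∀ n, iIndepFun (fun e : (completeGraphOn n).edgeSet => X n e) (P n))
    (hlaw : ∀ n, ∀ e ∈ (completeGraphOn n).edgeSet,
      IdentDistrib (X n e) (fun ω => Z ω ^ s n) (P n) μ)
    (hab : ∀ n, 2 ≤ n → a n ∈ Set.Icc 1 n ∧ b n ∈ Set.Icc 1 n ∧ a n ≠ b n)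
    (hu : ∀ᶠ n in atTop, 0 < u n ∧ u n ^ (1 / s n) ≤ C / n ∧ G (u n ^ (1 / s n)) = 1 / n) :
    Tendsto (fun n => (P n).real {ω | ∃ p : SAPath n (a n) (b n),
      weight (fun e => X n e ω) p ≤ Real.exp 1 * ⌈s n * Real.log n⌉₊ * u n}) atTop (𝓝 1) := by
  refine tendsto_of_tendsto_of_tendsto_of_le_of_le' (tendsto_second_moment_ratio hs0 hs₁ hs₂)
    tendsto_const_nhds ?_ (Eventually.of_forall fun n => measureReal_le_one)
  -- This accuracy suffices for `999 / 1001 * (65 / 64) ≥ 101 / 100` and for a layer of relative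
  -- mass below `1 / 16`.
  obtain ⟨δ, hδ, hlin⟩ := exists_linear_bounds hG0 hGd (η := 1 / 1000) (by norm_num)
  set g := derivWithin G (Set.Ici 0) 0 with hg
  filter_upwards [hu, (tendsto_exp_inv_mul_div hs0 hs₁ C).eventually_lt_const hδ,
    (tendsto_zero_of_sq_mul_log hs0 hs₂).eventually_le_const one_pos,
    hs₁.eventually_gt_atTop 0, eventually_ge_atTop 2,
    (tendsto_ceil_sq_div hs0 hs₁ hs₂).eventually_le_const one_pos]
    with n ⟨hu0, huC, hGz⟩ hδn hs1 hK hn hkn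
  have hs := hs0 n
  have hn0 : (0 : ℝ) < n := by exact_mod_cast (by omega : 0 < n)
  set k := ⌈s n * Real.log n⌉₊ with hk
  have hk0 : 0 < k := Nat.ceil_pos.2 hK
  have hkn' : k ≤ n := by
    rw [div_le_one hn0] at hkn
    have h1 : (1 : ℝ) ≤ k := by exact_mod_cast hk0
    have : (k : ℝ) ≤ n := by nlinarith
    exact_mod_cast this
  set z := u n ^ (1 / s n) with hz
  have hz0 : 0 < z := Real.rpow_pos_of_pos hu0 _
  -- The factor `1 + s n / 64` multiplies the edge probability by at least about `65 / 64`, which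
  -- makes the expected number of paths diverge.
  set T := Real.exp 1 * (1 + s n / 64) * u n with hT
  have hT0 : 0 < T := by positivity
  set q := (1 + s n / 64) ^ (1 / s n) with hq
  obtain ⟨hq1, hq2⟩ := one_add_div_rpow_inv_bounds hs hs1
  set y := T ^ (1 / s n) with hy
  have hy0 : 0 < y := Real.rpow_pos_of_pos hT0 _
  have hyz : y = Real.exp (1 / s n) * q * z := by
    rw [hy, hT, Real.mul_rpow (by positivity) hu0.le, Real.mul_rpow (by positivity) (by positivity),
      Real.exp_one_rpow]
  have hE1 : 1 ≤ Real.exp (1 / s n) := Real.one_le_exp (by positivity)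
  have hyδ : y < δ := by
    refine lt_of_le_of_lt ?_ hδn
    rw [hyz, Real.exp_add]
    gcongr
  have hzy : z ≤ y := by
    rw [hyz]
    have : 1 ≤ Real.exp (1 / s n) * q := one_le_mul_of_one_le_of_one_le hE1 (by linarith)
    exact le_mul_of_one_le_left hz0.le this
  have hby := hlin y hy0 hyδ
  have hbz := hlin z hz0 (hzy.trans_lt hyδ)
  have hGyp : 0 < G y := lt_of_lt_of_le (by positivity) hby.1
  -- The layer has about `1 / 32` of the mass below `T`. Half of the edges below it save a relative
  -- `s n / 64`, cancelling the overshoot of `T`: `(1 + s n / 64) * (1 - s n / 64) ≤ 1`.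
  set T' := T * (1 - s n / 32) with hT'
  have hs32 : 0 ≤ 1 - s n / 32 := by linarith
  have hT'0 : 0 ≤ T' := by positivity
  have hT'T : T' ≤ T := mul_le_of_le_one_right hT0.le (by linarith)
  have hp : μ.real {ω | Z ω ^ s n ≤ T} = G y := by
    rw [measureReal_rpow_le hZpos hs hT0.le, hG]
  have hp' : μ.real {ω | Z ω ^ s n ≤ T'} = G (T' ^ (1 / s n)) := by
    rw [measureReal_rpow_le hZpos hs hT'0, hG]
  have hmono : Monotone G := fun x x' h => by
    rw [hG, hG]
    exact measureReal_mono fun ω (hω : Z ω ≤ x) => hω.trans h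
  have hGT' : (1 - 1 / 1000) * g * (31 / 32 * y) ≤ G (T' ^ (1 / s n)) := by
    refine (hlin (31 / 32 * y) (by positivity) (by linarith)).1.trans (hmono ?_)
    rw [hT', Real.mul_rpow hT0.le hs32, ← hy, mul_comm]
    exact mul_le_mul_of_nonneg_left (le_one_sub_div_rpow_inv hs hs1) hy0.le
  have hYm : Measurable fun ω => Z ω ^ s n := hZ.pow_const _
  have hl : μ.real {ω | T' < Z ω ^ s n ∧ Z ω ^ s n ≤ T} ≤ μ.real {ω | Z ω ^ s n ≤ T} / 16 := by
    have h1 : μ.real {ω | T' < Z ω ^ s n ∧ Z ω ^ s n ≤ T} + μ.real {ω | Z ω ^ s n ≤ T'} =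
        μ.real {ω | Z ω ^ s n ≤ T} :=
      measureReal_Ioc_add hYm hT'T
    rw [hp, hp'] at h1
    rw [hp]
    have hgy : 0 < g * y := by positivity
    linarith [hby.1, hby.2]
  have hv : (k : ℝ) * T - k / 2 * (T - T') ≤ Real.exp 1 * k * u n := by
    have h1 : (k : ℝ) * T - k / 2 * (T - T') =
        Real.exp 1 * k * u n * (1 - (s n / 64) ^ 2) := by
      rw [hT', hT]; ring
    rw [h1]
    exact mul_le_of_le_one_right (by positivity) (sub_le_self _ (sq_nonneg _))
  obtain ⟨ha, hb, hne⟩ := hab n hn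
  have hsm := second_moment_bound (a := a n) (b := b n) (by omega) (hind n) (hlaw n)
    hYm.aemeasurable hT'T
    (by rw [hp]; exact hGyp) hl k hv
  rw [hp] at hsm
  refine le_measureReal_of_second_moment hk0 hkn' (by omega) hGyp hs measureReal_nonneg ?_
    (Nat.le_ceil _) ?_ hsm
  · have h1 : 1 ≤ n * ((1 + 1 / 1000) * g * z) := by
      have := mul_le_mul_of_nonneg_left hbz.2 hn0.le
      rwa [hGz, mul_one_div_cancel hn0.ne'] at this
    have h2 : (n : ℝ) * ((1 - 1 / 1000) * g * y) ≤ n * G y :=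
      mul_le_mul_of_nonneg_left hby.1 hn0.le
    have h3 : (n : ℝ) * ((1 - 1 / 1000) * g * y) =
        (999 / 1001) * Real.exp (1 / s n) * q * (n * ((1 + 1 / 1000) * g * z)) := by
      rw [hyz]; ring
    have h4 : 101 / 100 * Real.exp (1 / s n) ≤ (999 / 1001) * Real.exp (1 / s n) * q := by
      have h6 : 101 / 100 ≤ 999 / 1001 * q := by linarith
      calc 101 / 100 * Real.exp (1 / s n) ≤ 999 / 1001 * q * Real.exp (1 / s n) :=
            mul_le_mul_of_nonneg_right h6 (Real.exp_nonneg _)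
        _ = _ := by ring
    have h5 : (999 / 1001) * Real.exp (1 / s n) * q ≤
        (999 / 1001) * Real.exp (1 / s n) * q * (n * ((1 + 1 / 1000) * g * z)) :=
      le_mul_of_one_le_right (by positivity) h1
    linarith
  · obtain ⟨j, hj⟩ := Nat.exists_eq_add_of_lt hk0
    rw [zero_add] at hj
    have := pow_le_card_paths n j ha hb hne
    rw [hj, Nat.add_sub_cancel, ← Nat.sub_sub]
    exact this

end SecondMomentLimit

end FPP

/-! ### Null sets, convergence in probability and assembly. -/

namespace FPP

theorem measure_eq_zero_of_continuous_cdf {Ω₀ : Type*} [MeasurableSpace Ω₀] {μ : Measure Ω₀}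
    [IsFiniteMeasure μ] {Z : Ω₀ → ℝ} (hZ : Measurable Z) {G : ℝ → ℝ}
    (hG : ∀ x, G x = μ.real {ω | Z ω ≤ x}) (hcont : Continuous G) (y : ℝ) :
    μ {ω | Z ω = y} = 0 := by
  have h1 : ∀ x < y, μ.real {ω | Z ω = y} ≤ G y - G x := by
    intro x hx
    have h2 := measureReal_Ioc_add (μ := μ) hZ hx.le
    rw [← hG, ← hG] at h2
    have h3 : μ.real {ω | Z ω = y} ≤ μ.real {ω | x < Z ω ∧ Z ω ≤ y} :=
      measureReal_mono fun ω (hω : Z ω = y) => ⟨hω ▸ hx, hω.le⟩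
    linarith
  have h2 : Tendsto (fun x => G y - G x) (𝓝[<] y) (𝓝 0) := by
    have := (tendsto_const_nhds (x := G y)).sub ((hcont.tendsto y).mono_left (nhdsWithin_le_nhds (s := Set.Iio y)))
    rwa [sub_self] at this
  have h3 : μ.real {ω | Z ω = y} ≤ 0 :=
    ge_of_tendsto h2 (eventually_nhdsWithin_of_forall fun x hx => h1 x hx)
  exact (measureReal_eq_zero_iff).1 (le_antisymm h3 measureReal_nonneg)

theorem nullMeasurableSet_exists_weight_le {Ω : Type*} [MeasurableSpace Ω] {P : Measure Ω}
    {n a b : ℕ} {X : Sym2 ℕ → Ω → ℝ}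
    (hX : ∀ e ∈ (completeGraphOn n).edgeSet, AEMeasurable (X e) P) (v : ℝ) :
    NullMeasurableSet {ω | ∃ p : SAPath n a b, weight (fun e => X e ω) p ≤ v} P := by
  have h : {ω | ∃ p : SAPath n a b, weight (fun e => X e ω) p ≤ v} =
      ⋃ p : SAPath n a b, {ω | ∑ e ∈ p.1.edges.toFinset, X e ω ≤ v} := by
    ext ω
    simp [weight_eq_sum]
  have : Countable (SAPath n a b) := Finite.to_countable
  rw [h]
  exact NullMeasurableSet.iUnion fun p => nullMeasurableSet_le
    (Finset.aemeasurable_fun_sum _ fun e he =>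
      hX e (p.1.edges_subset_edgeSet (List.mem_toFinset.1 he))) aemeasurable_const

section Whp

variable {Ω : ℕ → Type*} [∀ n, MeasurableSpace (Ω n)] {P : ∀ n, Measure (Ω n)}

theorem Whp.of_compl [∀ n, IsProbabilityMeasure (P n)] {A : ∀ n, Set (Ω n)}
    (h : Tendsto (fun n => P n (A n)ᶜ) atTop (𝓝 0)) : Whp P A := by
  have h1 : Tendsto (fun n => 1 - P n (A n)ᶜ) atTop (𝓝 1) := by
    simpa using ENNReal.Tendsto.sub (tendsto_const_nhds (x := (1 : ℝ≥0∞))) h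
      (Or.inl ENNReal.one_ne_top)
  refine tendsto_of_tendsto_of_tendsto_of_le_of_le h1 tendsto_const_nhds (fun n => ?_)
    fun n => prob_le_one
  rw [tsub_le_iff_right, ← measure_univ (μ := P n), ← Set.union_compl_self (A n)]
  exact measure_union_le _ _

theorem tendsto_measure_zero_of_subset_union {A B C : ∀ n, Set (Ω n)}
    (hB : Tendsto (fun n => P n (B n)) atTop (𝓝 0)) (hC : Tendsto (fun n => P n (C n)) atTop (𝓝 0))
    (h : ∀ᶠ n in atTop, A n ⊆ B n ∪ C n) : Tendsto (fun n => P n (A n)) atTop (𝓝 0) := by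
  have h1 := hB.add hC
  rw [add_zero] at h1
  exact tendsto_of_tendsto_of_tendsto_of_le_of_le' tendsto_const_nhds h1
    (Eventually.of_forall fun n => zero_le)
    (h.mono fun n hn => (measure_mono hn).trans (measure_union_le _ _))

theorem tendstoInProb_of_bounds {A : ∀ n, Set (Ω n)} {Y : ∀ n, Ω n → ℝ} {l r : ℕ → ℝ} {c : ℝ}
    (hA : Tendsto (fun n => P n (A n)ᶜ) atTop (𝓝 0)) (hl : Tendsto l atTop (𝓝 c))
    (hr : Tendsto r atTop (𝓝 c)) (h : ∀ᶠ n in atTop, ∀ ω ∈ A n, l n ≤ Y n ω ∧ Y n ω ≤ r n) :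
    TendstoInProb P Y c := by
  intro δ hδ
  refine tendsto_of_tendsto_of_tendsto_of_le_of_le' tendsto_const_nhds hA
    (Eventually.of_forall fun n => zero_le) ?_
  filter_upwards [h, hl.eventually_const_lt (show c - δ < c by linarith),
    hr.eventually_lt_const (show c < c + δ by linarith)] with n hn h1 h2
  refine measure_mono fun ω (hω : δ ≤ |Y n ω - c|) hωA => ?_
  obtain ⟨h3, h4⟩ := hn ω hωA
  rcases le_abs.1 hω with h5 | h5 <;> linarith

end Whp

end FPP

theorem theorem1p1
    -- the positive random variable `Z` with continuous distribution function `G`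
    {Ω₀ : Type*} [MeasurableSpace Ω₀] (μ : Measure Ω₀) [IsProbabilityMeasure μ]
    (Z : Ω₀ → ℝ) (hZ : Measurable Z) (hZpos : ∀ᵐ ω ∂μ, 0 < Z ω)
    (G : ℝ → ℝ) (hG : ∀ x, G x = μ.real {ω | Z ω ≤ x}) (hGcont : Continuous G)
    (xhat : ℝ) (hxhat : 0 < xhat)
    (hGC2 : ContDiffOn ℝ 2 G (Set.Icc 0 xhat))
    (hGmono : StrictMonoOn G (Set.Icc 0 xhat))
    (hGderiv : 0 < derivWithin G (Set.Ici 0) 0)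
    -- the sequence `s_n`
    (s : ℕ → ℝ) (hspos : ∀ n, 0 < s n)
    (hs₁ : Tendsto (fun n : ℕ => s n * Real.log n) atTop atTop)
    (hs₂ : Tendsto (fun n : ℕ => s n ^ 2 * Real.log n) atTop (𝓝 0))
    -- i.i.d. edge weights on `K_n`, distributed as `Z ^ s_n`
    {Ω : ℕ → Type*} [∀ n, MeasurableSpace (Ω n)] (P : ∀ n, Measure (Ω n))
    [∀ n, IsProbabilityMeasure (P n)]
    (X : ∀ n, Sym2 ℕ → Ω n → ℝ)
    (hXindep : ∀ n, iIndepFun (fun (e : (FPP.completeGraphOn n).edgeSet) => X n e) (P n))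
    (hXlaw : ∀ n, ∀ e ∈ (FPP.completeGraphOn n).edgeSet,
      IdentDistrib (X n e) (fun ω => Z ω ^ s n) (P n) μ)
    -- two distinct vertices of `K_n`
    (a b : ℕ → ℕ)
    (hab : ∀ n, 2 ≤ n → a n ∈ Set.Icc 1 n ∧ b n ∈ Set.Icc 1 n ∧ a n ≠ b n)
    -- the distribution function `F_n` of the edge weights, and `u_n`, `ε_n`, `W_n`, `H_n`
    (F : ℕ → ℝ → ℝ) (hF : ∀ n x, F n x = μ.real {ω | Z ω ^ s n ≤ x})
    (u : ℕ → ℝ) (hu : ∀ n, u n = FPP.scale n (F n))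
    (ε : ℕ → ℝ) (hε : ∀ n : ℕ, ε n = √(s n * Real.log (Real.log n)))
    (W : ∀ n, Ω n → ℝ)
    (hW : ∀ n ω, W n ω = FPP.minWeight n (a n) (b n) (fun e => X n e ω))
    (H : ∀ n, Ω n → ℕ)
    (hH : ∀ n ω, H n ω = FPP.hopcount n (a n) (b n) (fun e => X n e ω)) :
    -- `u_n` is well defined for large `n`, and the optimal path is almost surely unique
    (∀ᶠ n in atTop, FPP.scaleSet n (F n) = {u n}) ∧
    (∀ n, 2 ≤ n → ∀ᵐ ω ∂(P n), ∃! p : FPP.SAPath n (a n) (b n),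
      FPP.IsOptimal (fun e => X n e ω) p) ∧
    -- bounds for the weight with high probability
    Tendsto ε atTop (𝓝 0) ∧
    FPP.Whp P (fun n => {ω |
      (1 - ε n) * Real.exp 1 * (⌊s n * Real.log n⌋₊ : ℝ) * u n ≤ W n ω ∧
      W n ω ≤ Real.exp 1 * (⌈s n * Real.log n⌉₊ : ℝ) * u n}) ∧
    -- first order asymptotics of the weight and of the hopcount
    FPP.TendstoInProb P (fun n ω => W n ω / (u n * s n * Real.log n)) (Real.exp 1) ∧
    FPP.TendstoInProb P (fun n ω => (H n ω : ℝ) / (s n * Real.log n)) 1 := by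
  have hG0 : G 0 = 0 := by
    rw [hG, measureReal_def, measure_eq_zero_iff_ae_notMem.2, ENNReal.toReal_zero]
    exact hZpos.mono fun ω hω h => absurd h (not_le.2 hω)
  have hmono : Monotone G := fun x y h => by
    rw [hG, hG]
    exact measureReal_mono fun ω (hω : Z ω ≤ x) => hω.trans h
  obtain ⟨C, hC1, hC, hq⟩ := FPP.exists_quantile_bounds hG0 hmono
    (fun x => by rw [hG]; exact measureReal_le_one) hGcont hxhat hGmono hGderiv
  have hC' : ∀ x, 0 < x → μ.real {ω | Z ω ≤ x} ≤ C * x := fun x hx => by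
    rw [← hG]; exact hC x hx
  have hscale : ∀ᶠ n in atTop, FPP.scaleSet n (F n) = {u n} ∧ 0 < u n ∧
      u n ^ (1 / s n) ≤ C / n ∧ G (u n ^ (1 / s n)) = 1 / n := by
    filter_upwards [hq, eventually_gt_atTop 0] with n ⟨z, hz0, hzC, hGz, hzu⟩ hn
    have h1 := FPP.scaleSet_eq_singleton (F := F n) (hspos n) hn (fun x hx => by
      rw [hF, FPP.measureReal_rpow_le hZpos (hspos n) hx.le, ← hG]) hz0 hGz hzu
    have h2 : u n = z ^ s n := by rw [hu, FPP.scale, h1, csInf_singleton]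
    have h3 : u n ^ (1 / s n) = z := by
      rw [h2, ← Real.rpow_mul hz0.le, mul_one_div_cancel (hspos n).ne', Real.rpow_one]
    rw [h3]
    exact ⟨h1.trans (by rw [h2]), h2 ▸ Real.rpow_pos_of_pos hz0 _, hzC, hGz⟩
  have hu' : ∀ᶠ n in atTop, 0 < u n ∧ u n ^ (1 / s n) ≤ C / n :=
    hscale.mono fun n h => ⟨h.2.1, h.2.2.1⟩
  have hne : ∀ᶠ n in atTop, a n ≠ b n :=
    (eventually_ge_atTop 2).mono fun n hn => (hab n hn).2.2
  have hpath : ∀ n, 2 ≤ n → Nonempty (FPP.SAPath n (a n) (b n)) := fun n hn =>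
    FPP.nonempty_SAPath (hab n hn).1 (hab n hn).2.1 (hab n hn).2.2
  have hε0 : Tendsto ε atTop (𝓝 0) := by
    simpa only [← hε] using FPP.tendsto_sqrt_mul_log_log hspos hs₂
  set good : ∀ n, Set (Ω n) := fun n => {ω | ∃ p : FPP.SAPath n (a n) (b n),
    FPP.weight (fun e => X n e ω) p ≤ Real.exp 1 * ⌈s n * Real.log n⌉₊ * u n} with hgood
  have hgoodc : Tendsto (fun n => P n (good n)ᶜ) atTop (𝓝 0) := by
    have h1 := FPP.tendsto_measureReal_exists_path_le_ceil hZ hZpos hG hG0 hGderiv hspos hs₁ hs₂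
      hXindep hXlaw hab (hscale.mono fun n h => h.2)
    have h2 := ENNReal.tendsto_ofReal ((tendsto_const_nhds (x := (1 : ℝ))).sub h1)
    rw [sub_self, ENNReal.ofReal_zero] at h2
    refine h2.congr fun n => ?_
    rw [← probReal_compl_eq_one_sub₀ (FPP.nullMeasurableSet_exists_weight_le
      (fun e he => (hXlaw n e he).aemeasurable_fst) _), ofReal_measureReal]
  have hlight := FPP.tendsto_measure_light_path hZ hZpos hC1 hC' hspos hs₁ hs₂ hXindep hXlaw hne hu'
  simp only [← hε] at hlight
  set A : ∀ n, Set (Ω n) := fun n => {ω |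
      (1 - ε n) * Real.exp 1 * (⌊s n * Real.log n⌋₊ : ℝ) * u n ≤ W n ω ∧
      W n ω ≤ Real.exp 1 * (⌈s n * Real.log n⌉₊ : ℝ) * u n} with hA
  have hAc : Tendsto (fun n => P n (A n)ᶜ) atTop (𝓝 0) := by
    -- The weight bounds fail only if some path is too light or no path is light enough.
    refine FPP.tendsto_measure_zero_of_subset_union hlight hgoodc ?_
    filter_upwards [eventually_ge_atTop 2] with n hn ω hω
    have := hpath n hn
    obtain ⟨p, hp⟩ := FPP.exists_isOptimal (n := n) (a := a n) (b := b n) (fun e => X n e ω)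
    have hWp : W n ω = FPP.weight (fun e => X n e ω) p := by
      rw [hW, FPP.minWeight_eq_of_isOptimal hp]
    by_contra hcon
    rw [Set.mem_union, not_or, Set.mem_compl_iff, not_not] at hcon
    obtain ⟨q, hq⟩ := hcon.2
    refine hω ⟨?_, hWp.le.trans ((hp q).trans hq)⟩
    by_contra hlt
    exact hcon.1 ⟨p, hWp.ge.trans (not_le.1 hlt).le⟩
  have hK : ∀ᶠ n : ℕ in atTop, 0 < s n * Real.log n := hs₁.eventually_gt_atTop 0
  refine ⟨hscale.mono fun n h => h.1, fun n hn => ?_, hε0, FPP.Whp.of_compl hAc, ?_, ?_⟩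
  · have := hpath n hn
    refine FPP.ae_existsUnique_isOptimal (hXindep n)
      (fun e he => (hXlaw n e he).aemeasurable_fst) fun e he x => ?_
    have h1 : P n (X n e ⁻¹' {x}) = μ ((fun ω => Z ω ^ s n) ⁻¹' {x}) :=
      (hXlaw n e he).measure_mem_eq (measurableSet_singleton x)
    refine h1.trans (le_antisymm ?_ zero_le)
    refine (measure_mono_ae (hZpos.mono fun ω hω hx => ?_)).trans
      (FPP.measure_eq_zero_of_continuous_cdf hZ hG hGcont (x ^ (1 / s n))).le
    change Z ω = x ^ (1 / s n)
    rw [← (show Z ω ^ s n = x from hx), ← Real.rpow_mul hω.le, mul_one_div_cancel (hspos n).ne',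
      Real.rpow_one]
  · have hl : Tendsto (fun n : ℕ => (1 - ε n) * Real.exp 1 *
        ((⌊s n * Real.log n⌋₊ : ℝ) / (s n * Real.log n))) atTop (𝓝 (Real.exp 1)) := by
      simpa using (((tendsto_const_nhds (x := (1 : ℝ))).sub hε0).mul_const (Real.exp 1)).mul
        (FPP.tendsto_floor_div hs₁)
    have hr : Tendsto (fun n : ℕ => Real.exp 1 *
        ((⌈s n * Real.log n⌉₊ : ℝ) / (s n * Real.log n))) atTop (𝓝 (Real.exp 1)) := by
      simpa using (FPP.tendsto_ceil_div hs₁).const_mul (Real.exp 1)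
    refine FPP.tendstoInProb_of_bounds hAc hl hr ?_
    filter_upwards [hK, hu'] with n hKn hun ω hω
    have hpos : 0 < u n * s n * Real.log n := by
      rw [mul_assoc]; exact mul_pos hun.1 hKn
    rw [le_div_iff₀ hpos, div_le_iff₀ hpos]
    have e1 : ∀ x : ℝ, x / (s n * Real.log n) * (u n * s n * Real.log n) = x * u n := by
      intro x
      rw [mul_assoc (u n), mul_comm (u n), ← mul_assoc, div_mul_cancel₀ _ hKn.ne']
    rw [mul_assoc _ (_ / _), mul_assoc _ (_ / _), e1, e1, ← mul_assoc, ← mul_assoc]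
    exact hω
  · intro δ hδ
    -- The length estimate needs a deviation of at most one; replacing `δ` by `min δ 1` only
    -- enlarges the event. When a good path exists, an optimal path realising the hopcount is at
    -- least as light, so an atypical hopcount yields a light path of atypical length.
    have hlen := FPP.tendsto_measure_atypical_length hZ hZpos hC1 hC' hspos hs₁ hs₂ hXindep hXlaw
      hne hu' (lt_min hδ one_pos) (min_le_right δ 1)
    refine FPP.tendsto_measure_zero_of_subset_union hlen hgoodc ?_
    filter_upwards [eventually_ge_atTop 2] with n hn ω hω
    have := hpath n hn
    by_cases hg : ω ∈ good n
    · obtain ⟨p, hpW, hpH⟩ := FPP.exists_weight_eq_minWeight_length_eq_hopcount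
        (n := n) (a := a n) (b := b n) (fun e => X n e ω)
      obtain ⟨q, hq⟩ := hg
      refine Or.inl ⟨p, ?_, ?_⟩
      · rw [hpH, ← hH]
        exact (min_le_left δ 1).trans hω
      · rw [hpW]
        exact (ciInf_le (Set.finite_range _).bddBelow q).trans hq
    · exact Or.inr hg
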